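/- Consider the following cell. An access point (AP) sits at the origin of $\mathbb R^2$; the downlink (DL) users form a homogeneous Poisson point process of intensity $\lambda_d>0$, and those within the disk of radius $R_c>0$ around the AP are in the cell. The AP schedules the nearest DL user, at distance $r$, and an uplink (UL) user at distance $d>0$ from that DL user in a uniformly random direction, so that the UL user's position $x_u$ satisfies $\|x_u\|^2=r^2+d^2-2rd\cos\theta$ with $\theta$ uniform on $[0,2\pi]$. The AP has one receive antenna ($n_u=1$) and $n_d\ge 1$ transmit antennas. The UL channel $h_{ua}\in\mathbb C$ has law $\mathcal{CN}(0,1)$, the DL channel $\mathbf h_{ad}\in\mathbb C^{1\times n_d}$ has i.i.d. $\mathcal{CN}(0,1)$ entries, and the loopback channel $\mathbf h_{aa}\in\mathbb C^{1\times n_d}$ has i.i.d. $\mathcal{CN}(0,\sigma_{aa}^2)$ entries, $\sigma_{aa}>0$. The point process, $\theta$ and the three channels are independent. Let $P_u,P_a>0$ be the transmit powers of the UL user and of the AP. In the interference-limited case (no noise), with path loss exponent $\alpha=4$, receive vector (MRC) $w_r=h_{ua}^\dagger/|h_{ua}|$ and transmit vector (MRT) $\mathbf w_t=\mathbf h_{ad}^\dagger/\|\mathbf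 h_{ad}\|$, put $$\mathsf{SINR}_a=\frac{P_u\,\|x_u\|^{-4}\,|w_r h_{ua}|^2}{P_a\,|w_r\mathbf h_{aa}\mathbf w_t|^2},$$ and let $R_a=\mathbb E[\log_2(1+\mathsf{SINR}_a)\,\mathbf 1_{\{r\le R_c\}}]$ be the spatial average rate of the UL user (no rate is counted when there is no DL user in the cell). Then $R_a$ is finite, the series below converges to a real number, and $$R_a<\frac{1}{2\log 2}\sum_{k=0}^{\infty}\frac{(-1)^k(\lambda_d\pi R_c^2)^{k+1}}{\Gamma(k+1)}\;G^{3,2}_{3,3}\!\left(\frac{P_u}{P_a}\,\frac{1}{R_c^4\sigma_{aa}^2}\;\middle|\;{1,\;1,\;1+\frac{k+1}{2}\atop 1,\;1,\;\frac{k+1}{2}}\right),$$ where $\log$ is the natural logarithm and $G$ is the Meijer G-function, here $$G^{3,2}_{3,3}\!\left(z\,\middle|\,{a_1,a_2,a_3\atop b_1,b_2,b_3}\right)=\frac1{2\pi i}\int_{L}\frac{\Gamma(b_1-s)\Gamma(b_2-s)\Gamma(b_3-s)\Gamma(1-a_1+s)\Gamma(1-a_2+s)}{\Gamma(a_3-s)}\,z^s\,ds,$$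 $L$ being a vertical line, run upwards, that has the poles of the $\Gamma(b_j-s)$ on its right and those of the $\Gamma(1-a_j+s)$ on its left. -/

import Mathlib

open MeasureTheory ProbabilityTheory
open scoped NNReal

noncomputable section

namespace FullDuplex

/-- The law `CN(0, v)` of a circularly symmetric complex Gaussian variable: the real and imaginary
parts are independent centred real Gaussians of variance `v / 2` each. -/
def complexGaussian (v : ℝ≥0) : Measure ℂ :=
  ((gaussianReal 0 (v / 2)).prod (gaussianReal 0 (v / 2))).map
    (fun p : ℝ × ℝ => (p.1 : ℂ) + (p.2 : ℂ) * Complex.I)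

/-- The uniform distribution on `[0, 2π]`. -/
def uniformAngle : Measure ℝ :=
  (ENNReal.ofReal (2 * Real.pi))⁻¹ • volume.restrict (Set.Icc 0 (2 * Real.pi))

/-- The number of points of the random point set `Φ` in the region `B`. -/
def pointCount {Ω : Type*} (Φ : Ω → Set ℂ) (B : Set ℂ) (ω : Ω) : ℕ∞ := (Φ ω ∩ B).encard

/-- The σ-algebra on the sample space generated by all the counts `pointCount Φ B`, for
Borel sets `B` of the plane. -/
@[reducible] def pointSigma {Ω : Type*} (Φ : Ω → Set ℂ) : MeasurableSpace Ω :=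
  ⨆ (B : Set ℂ) (_ : MeasurableSet B), MeasurableSpace.comap (pointCount Φ B) ⊤

/-- `Φ` is a homogeneous Poisson point process on the plane `ℝ² = ℂ` with intensity `lam`: the
number of points in a Borel set of finite area is Poisson distributed with mean `lam` times the
area, and the numbers of points in disjoint Borel sets are independent. -/
structure IsHomogeneousPPP {Ω : Type*} [MeasurableSpace Ω] (P : Measure Ω) (lam : ℝ≥0)
    (Φ : Ω → Set ℂ) : Prop where
  measurable_count : ∀ B : Set ℂ, MeasurableSet B → Measurable (pointCount Φ B)
  law_count : ∀ B : Set ℂ, MeasurableSet B → volume B ≠ ⊤ →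
    P.map (pointCount Φ B) =
      (poissonMeasure (lam * (volume B).toNNReal)).map (fun n : ℕ => (n : ℕ∞))
  indep_count : ∀ (n : ℕ) (B : Fin n → Set ℂ), (∀ i, MeasurableSet (B i)) →
    Pairwise (fun i j => Disjoint (B i) (B j)) → iIndepFun (fun i => pointCount Φ (B i)) P

/-- The random quantities of the cell and their joint law. The access point (AP) sits at the origin.
* `Φ`: locations of the downlink users, a homogeneous Poisson process of intensity `lam`;
* `Θ`: the angle fixing the direction of the uplink user as seen from the scheduled downlink user;
* `hua`: the channel from the uplink user to the `nu` receive antennas, i.i.d. `CN(0, 1)` entries;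
* `had`: the channel from the `nd` transmit antennas to the scheduled downlink user, i.i.d.
  `CN(0, 1)` entries;
* `Haa`: the `nu × nd` loopback interference channel, i.i.d. `CN(0, saa ^ 2)` entries.
All five are independent. -/
structure IsCell {Ω : Type*} [MeasurableSpace Ω] (P : Measure Ω) (nu nd : ℕ) (lam saa : ℝ≥0)
    (Φ : Ω → Set ℂ) (Θ : Ω → ℝ) (hua : Ω → Fin nu → ℂ) (had : Ω → Fin nd → ℂ)
    (Haa : Ω → Fin nu → Fin nd → ℂ) : Prop where
  users : IsHomogeneousPPP P lam Φ
  measurable_angle : Measurable Θ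
  law_angle : P.map Θ = uniformAngle
  measurable_hua : Measurable hua
  law_hua : P.map hua = Measure.pi (fun _ => complexGaussian 1)
  measurable_had : Measurable had
  law_had : P.map had = Measure.pi (fun _ => complexGaussian 1)
  measurable_Haa : Measurable Haa
  law_Haa : P.map Haa = Measure.pi (fun _ => Measure.pi (fun _ => complexGaussian (saa ^ 2)))
  indep : iIndep ![pointSigma Φ, MeasurableSpace.comap Θ inferInstance,
    MeasurableSpace.comap hua inferInstance, MeasurableSpace.comap had inferInstance,
    MeasurableSpace.comap Haa inferInstance] P

/-- The singular path loss `ℓ(x) = ‖x‖ ^ (-α)` between a node at `x` and the AP at the origin. -/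
def pathLoss (α : ℝ) (x : ℂ) : ℝ := ‖x‖ ^ (-α)

/-- The distance from the AP to the nearest downlink user, which is the scheduled one. -/
def nearestDist (S : Set ℂ) : ℝ := Metric.infDist 0 S

/-- The location of the uplink user in the coordinates in which the scheduled downlink user is at
`(r, 0)`: at distance `d` from it, in the direction that makes the angle `θ` with the direction
towards the AP. Thus `‖ulPosition r d θ‖ ^ 2 = r ^ 2 + d ^ 2 - 2 * r * d * cos θ`. -/
def ulPosition (r d θ : ℝ) : ℂ := (r : ℂ) - (d : ℂ) * Complex.exp ((θ : ℂ) * Complex.I)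

/-- The normalized conjugate `h† / ‖h‖`: the MRC combining vector for `h = h_ua` and the MRT
precoding vector for `h = h_ad`. -/
def matchedVector {n : ℕ} (h : Fin n → ℂ) : Fin n → ℂ :=
  fun i => star (h i) / ((‖WithLp.toLp 2 h‖ : ℝ) : ℂ)

/-- The signal-to-interference-plus-noise ratio at the AP for the receive vector `wr` and the
transmit vector `wt`, with uplink path loss `l` and noise power `sn2`. -/
def sinrAP {nu nd : ℕ} (Pu Pa sn2 l : ℝ) (hua : Fin nu → ℂ) (Haa : Fin nu → Fin nd → ℂ)
    (wr : Fin nu → ℂ) (wt : Fin nd → ℂ) : ℝ :=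
  (Pu * l * ‖wr ⬝ᵥ hua‖ ^ 2) /
    (Pa * ‖wr ⬝ᵥ (Matrix.of Haa).mulVec wt‖ ^ 2 + sn2 * ‖WithLp.toLp 2 wr‖ ^ 2)

/-- The instantaneous uplink rate `log₂ (1 + SINR)` under MRC reception and MRT transmission. It is
zero when there is no downlink user in the cell, the disk of radius `Rc` around the AP. -/
def uplinkRate {nu nd : ℕ} (Pu Pa sn2 Rc d α : ℝ) (S : Set ℂ) (θ : ℝ) (hua : Fin nu → ℂ)
    (had : Fin nd → ℂ) (Haa : Fin nu → Fin nd → ℂ) : ℝ :=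
  open scoped Classical in
  if nearestDist S ≤ Rc then
    Real.logb 2 (1 + sinrAP Pu Pa sn2 (pathLoss α (ulPosition (nearestDist S) d θ)) hua Haa
      (matchedVector hua) (matchedVector had))
  else 0

/-- The integrand of the Mellin-Barnes representation of the Meijer G-function
`G^{m,n}_{p,q}(z | a; b)`:
`∏_{j ≤ m} Γ(b_j - s) ∏_{j ≤ n} Γ(1 - a_j + s) / (∏_{j > m} Γ(1 - b_j + s) ∏_{j > n} Γ(a_j - s)) z^s`.
At a pole of a Gamma function in the denominator its reciprocal is `0`, as it should be. -/
def meijerIntegrand (m n : ℕ) {p q : ℕ} (a : Fin p → ℂ) (b : Fin q → ℂ) (z s : ℂ) : ℂ :=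
  (∏ j : Fin q,
      if (j : ℕ) < m then Complex.Gamma (b j - s) else (Complex.Gamma (1 - b j + s))⁻¹) *
    (∏ j : Fin p,
      if (j : ℕ) < n then Complex.Gamma (1 - a j + s) else (Complex.Gamma (a j - s))⁻¹) *
    z ^ s

/-- The vertical line `Re s = c` has the poles of all `Γ(b_j - s)`, `j ≤ m`, on its right and the
poles of all `Γ(1 - a_j + s)`, `j ≤ n`, on its left. -/
def IsSeparatingLine (m n : ℕ) {p q : ℕ} (a : Fin p → ℂ) (b : Fin q → ℂ) (c : ℝ) : Prop :=
  (∀ j : Fin q, (j : ℕ) < m → c < (b j).re) ∧ (∀ j : Fin p, (j : ℕ) < n → (a j).re - 1 < c)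

open scoped Classical in
/-- The Meijer G-function `G^{m,n}_{p,q}(z | a; b) = (1 / 2πi) ∫_L (...) ds` for parameters whose two
families of poles are separated by a vertical line `L`; the integral runs over such a line, from
`c - i∞` to `c + i∞`. For `p + q < 2 (m + n)` and `|arg z| < (m + n - (p + q) / 2) π` it converges
absolutely and all separating lines give the same value. -/
def meijerG (m n : ℕ) {p q : ℕ} (a : Fin p → ℂ) (b : Fin q → ℂ) (z : ℂ) : ℂ :=
  if h : ∃ c : ℝ, IsSeparatingLine m n a b c then
    (1 / (2 * (Real.pi : ℂ))) *
      ∫ t : ℝ, meijerIntegrand m n a b z ((h.choose : ℂ) + (t : ℂ) * Complex.I)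
  else 0

end FullDuplex

end

/-!
The rate is an integral over the plane. Matched filtering makes the signal and the interference
powers independent exponential variables (`lintegral_channels`), so that given the position of the
uplink user the mean rate is `g (C * ‖x_u‖ ^ (-4)) / log 2` with `C = Pu / (Pa * saa ^ 2)` and
`g c = E log (1 + c * X / Y) = ∫₀^∞ c / ((1 + c w) (1 + w)) dw` (`meanLogRatio`,
`lintegral_log_ratio`), `X` and `Y` being independent standard exponential variables. The distance
`r` to the nearest point of the Poisson process and the uniform angle `θ` are the polar coordinates
of a point `x = r * exp (i θ)` of the plane with density `lam * exp (-π lam ‖x‖ ^ 2)`, and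
`‖x_u‖ = ‖x - d‖`. Hence (`lintegral_uplinkRate`) the spatial average rate is
`(1 / log 2) ∫ ρ(x) g (C ‖x - d‖ ^ (-4)) dx`, where `ρ` is this density cut off at
radius `Rc`.

The right-hand side of the theorem is the same integral without the displacement `d`. Indeed, the
Mellin transform of `x ↦ ∫₀¹ v ^ k g (1 / (x v ^ 2)) dv` is `Γ(s)² Γ(1-s)² / (k + 1 - 2 s)`
(`hasMellin_powerMoment_inv`), so Mellin inversion identifies the `k`-th Meijer G-function with
`2 ∫₀¹ v ^ k g (z / v ^ 2) dv` (`meijerG_eq_powerMoment`), and summing the exponential series gives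
`∫₀¹ A exp (-A v) g (z / v ^ 2) dv` with `A = lam π Rc ^ 2`, which is the planar integral in the
variable `v = ‖x‖ ^ 2 / Rc ^ 2` (`integral_nearestDensity_mul_rateAtDist`).

For a fixed `r` the average over `θ` may exceed the value at `d = 0`; only the integral over the
plane is smaller. This is a rearrangement inequality for two functions decreasing in the distance
from the origin, one of which is translated. It is proved by reflection in the perpendicular
bisector of `0` and `d` (`integral_mul_comp_norm_sub_lt`).
-/

noncomputable section

namespace FullDuplex

/-! ### The mean of `log (1 + c * X / Y)` and Mellin transforms -/

theorem hasMellin_congr {f g : ℝ → ℂ} {s m : ℂ} (hf : HasMellin f s m)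
    (h : ∀ x : ℝ, 0 < x → f x = g x) : HasMellin g s m := by
  have key : Set.EqOn (fun t : ℝ => (t : ℂ) ^ (s - 1) • f t)
      (fun t : ℝ => (t : ℂ) ^ (s - 1) • g t) (Set.Ioi 0) := fun t ht => by
    simp only [h t ht]
  refine ⟨hf.1.congr_fun key measurableSet_Ioi, ?_⟩
  rw [← hf.2]
  exact (setIntegral_congr_fun measurableSet_Ioi key).symm

/-- The Mellin transform turns a superposition of dilates `x ↦ φ (a y * x)` into a product. Applied
three times, starting from `exp (-x)`, this gives the Mellin transforms behind the series. -/
theorem hasMellin_superposition {Y : Type*} [MeasurableSpace Y] {μ : Measure Y} [SFinite μ]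
    {φ : ℝ → ℂ} {h : Y → ℂ} {a : Y → ℝ} {s m c : ℂ} (hφm : Measurable φ) (hh : Measurable h)
    (ha : Measurable a) (hpos : ∀ᵐ y ∂μ, 0 < a y) (hφ : HasMellin φ s m)
    (hint : Integrable (fun y => h y * (a y : ℂ) ^ (-s)) μ)
    (hc : ∫ y, h y * (a y : ℂ) ^ (-s) ∂μ = c) :
    HasMellin (fun x => ∫ y, h y * φ (a y * x) ∂μ) s (c * m) := by
  set g : ℝ → ℂ := fun x => (x : ℂ) ^ (s - 1) * φ x with hg
  have hgint : IntegrableOn g (Set.Ioi 0) := hφ.1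
  have hgm : ∫ x in Set.Ioi (0 : ℝ), g x = m := hφ.2
  set F : Y × ℝ → ℂ := fun p => h p.1 * ((p.2 : ℂ) ^ (s - 1) * φ (a p.1 * p.2)) with hF
  have hFeq : ∀ y, 0 < a y → ∀ x : ℝ, 0 < x →
      F (y, x) = h y * (a y : ℂ) ^ (1 - s) * g (a y * x) := by
    intro y hy x hx
    have h1 : (a y : ℂ) ^ (1 - s) * (a y : ℂ) ^ (s - 1) = 1 := by
      rw [← Complex.cpow_add _ _ (by exact_mod_cast hy.ne')]
      simp
    simp only [hF, hg]
    rw [Complex.ofReal_mul, Complex.mul_cpow_ofReal_nonneg hy.le hx.le]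
    linear_combination (-(h y * (x : ℂ) ^ (s - 1) * φ (a y * x))) * h1
  have hpw : ∀ y, 0 < a y →
      (a y : ℂ) ^ (1 - s) * ((a y : ℂ))⁻¹ = (a y : ℂ) ^ (-s) := by
    intro y hy
    have hne : (a y : ℂ) ≠ 0 := by exact_mod_cast hy.ne'
    rw [← Complex.cpow_neg_one, ← Complex.cpow_add _ _ hne]
    congr 1; ring
  have hgscale : ∀ y, 0 < a y → IntegrableOn (fun x => g (a y * x)) (Set.Ioi 0) := by
    intro y hy
    rw [integrableOn_Ioi_comp_mul_left_iff _ _ hy]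
    simpa using hgint
  have hFm : Measurable F := by
    have : Measurable fun p : Y × ℝ => (p.2 : ℂ) ^ (s - 1) := by fun_prop
    simp only [hF]
    fun_prop
  have hFint : Integrable F (μ.prod (volume.restrict (Set.Ioi 0))) := by
    rw [integrable_prod_iff hFm.aestronglyMeasurable]
    constructor
    · filter_upwards [hpos] with y hy
      refine Integrable.congr ((hgscale y hy).const_mul (h y * (a y : ℂ) ^ (1 - s))) ?_
      refine (ae_restrict_iff' measurableSet_Ioi).2 (Filter.Eventually.of_forall fun x hx => ?_)
      exact (hFeq y hy x hx).symm
    · refine Integrable.congr (hint.norm.mul_const (∫ x in Set.Ioi (0 : ℝ), ‖g x‖)) ?_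
      filter_upwards [hpos] with y hy
      have h1 : ∫ x in Set.Ioi (0 : ℝ), ‖F (y, x)‖
          = ∫ x in Set.Ioi (0 : ℝ), ‖h y * (a y : ℂ) ^ (1 - s)‖ * ‖g (a y * x)‖ := by
        refine setIntegral_congr_fun measurableSet_Ioi fun x hx => ?_
        rw [hFeq y hy x hx, norm_mul]
      rw [h1, integral_const_mul, integral_comp_mul_left_Ioi (fun x => ‖g x‖) 0 hy, mul_zero,
        ← hpw y hy, smul_eq_mul, ← mul_assoc, ← mul_assoc, norm_mul (h y * _), norm_inv,
        Complex.norm_real, Real.norm_of_nonneg hy.le]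
  have hval : ∀ x : ℝ, ∫ y, F (y, x) ∂μ = (x : ℂ) ^ (s - 1) • ∫ y, h y * φ (a y * x) ∂μ := by
    intro x
    rw [smul_eq_mul, ← integral_const_mul]
    refine integral_congr_ae (Filter.Eventually.of_forall fun y => ?_)
    simp only [hF]; ring
  constructor
  · refine Integrable.congr hFint.integral_prod_right ?_
    exact Filter.Eventually.of_forall hval
  · unfold mellin
    simp_rw [← hval]
    rw [← integral_integral_swap (f := fun y x => F (y, x)) hFint, ← hc, ← integral_mul_const]
    refine integral_congr_ae ?_
    filter_upwards [hpos] with y hy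
    have h1 : ∫ x in Set.Ioi (0 : ℝ), F (y, x)
        = ∫ x in Set.Ioi (0 : ℝ), h y * (a y : ℂ) ^ (1 - s) * g (a y * x) :=
      setIntegral_congr_fun measurableSet_Ioi fun x hx => hFeq y hy x hx
    rw [h1, integral_const_mul, integral_comp_mul_left_Ioi g 0 hy, mul_zero, hgm, ← hpw y hy,
      Complex.real_smul, Complex.ofReal_inv]
    ring

theorem hasMellin_exp_neg {s : ℂ} (hs : 0 < s.re) :
    HasMellin (fun x : ℝ => (Real.exp (-x) : ℂ)) s (Complex.Gamma s) := by
  constructor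
  · have := Complex.GammaIntegral_convergent hs
    refine this.congr_fun (fun x _ => ?_) measurableSet_Ioi
    simp [mul_comm]
  · rw [Complex.Gamma_eq_integral hs, Complex.GammaIntegral_eq_mellin]

/-- The beta integral `∫₀^∞ x^(s-1) / (1+x) dx = Γ(s) Γ(1-s)`. -/
theorem hasMellin_inv_one_add {s : ℂ} (hs : 0 < s.re) (hs' : s.re < 1) :
    HasMellin (fun x : ℝ => (((1 + x)⁻¹ : ℝ) : ℂ)) s
      (Complex.Gamma s * Complex.Gamma (1 - s)) := by
  have h1 := hasMellin_exp_neg (s := 1 - s) (by simpa using hs')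
  have h2 : ∀ w : ℝ, (w : ℂ) ^ (1 - s - 1) • (Real.exp (-w) : ℂ)
      = (Real.exp (-w) : ℂ) * (w : ℂ) ^ (-s) := by
    intro w; rw [smul_eq_mul, mul_comm]; congr 2; ring
  have h3 : IntegrableOn (fun w : ℝ => (Real.exp (-w) : ℂ) * (w : ℂ) ^ (-s)) (Set.Ioi 0) := by
    have := h1.1
    simpa only [MellinConvergent, h2] using this
  have h4 : ∫ w in Set.Ioi (0 : ℝ), (Real.exp (-w) : ℂ) * (w : ℂ) ^ (-s)
      = Complex.Gamma (1 - s) := by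
    have := h1.2
    simpa only [mellin, h2] using this
  have := hasMellin_superposition (μ := volume.restrict (Set.Ioi (0 : ℝ)))
    (φ := fun x : ℝ => (Real.exp (-x) : ℂ)) (h := fun w : ℝ => (Real.exp (-w) : ℂ))
    (a := fun w => w) (by fun_prop) (by fun_prop) measurable_id
    (ae_restrict_mem measurableSet_Ioi) (hasMellin_exp_neg hs) h3 h4
  rw [mul_comm]
  refine hasMellin_congr this fun x hx => ?_
  have h5 : ∀ w : ℝ, (Real.exp (-w) : ℂ) * (Real.exp (-(w * x)) : ℂ)
      = ((Real.exp (-(1 + x) * w) : ℝ) : ℂ) := by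
    intro w
    rw [← Complex.ofReal_mul, ← Real.exp_add]; congr 2; ring
  simp_rw [h5]
  rw [integral_complex_ofReal, integral_exp_mul_Ioi (by linarith)]
  have : (1 : ℝ) + x ≠ 0 := by positivity
  congr 1
  simp only [mul_zero, Real.exp_zero]
  field_simp

/-- The mean of `log (1 + c * X / Y)` for independent standard exponential `X`, `Y`, as the integral
of the derivative `c / (1 + c w)` of `log (1 + c w)` against the tail `1 / (1 + w)` of `X / Y`. -/
def meanLogRatio (c : ℝ) : ℝ := ∫ w in Set.Ioi (0 : ℝ), c / ((1 + c * w) * (1 + w))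

theorem meanLogRatio_inv {x : ℝ} (hx : 0 < x) :
    meanLogRatio x⁻¹ = ∫ w in Set.Ioi (0 : ℝ), (w * (1 + w))⁻¹ * (1 + w⁻¹ * x)⁻¹ := by
  refine setIntegral_congr_fun measurableSet_Ioi fun w hw => ?_
  have hw : 0 < w := hw
  have : x + w ≠ 0 := by positivity
  have : w + x ≠ 0 := by positivity
  field_simp
  ring

theorem hasMellin_meanLogRatio_inv {s : ℂ} (hs : 0 < s.re) (hs' : s.re < 1) :
    HasMellin (fun x : ℝ => (meanLogRatio x⁻¹ : ℂ)) s
      (Complex.Gamma s * Complex.Gamma (1 - s) * (Complex.Gamma s * Complex.Gamma (1 - s))) := by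
  have h1 := hasMellin_inv_one_add hs hs'
  have h2 : ∀ w ∈ Set.Ioi (0 : ℝ), (w : ℂ) ^ (s - 1) • (((1 + w)⁻¹ : ℝ) : ℂ)
      = (((w * (1 + w))⁻¹ : ℝ) : ℂ) * ((w⁻¹ : ℝ) : ℂ) ^ (-s) := by
    intro w hw
    have hw : 0 < w := hw
    have hw' : (w : ℂ) ≠ 0 := by exact_mod_cast hw.ne'
    rw [Complex.ofReal_inv w, Complex.inv_cpow _ _ (by
      rw [Complex.arg_ofReal_of_nonneg hw.le]; exact Real.pi_pos.ne), Complex.cpow_neg, inv_inv,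
      Complex.cpow_sub _ _ hw', Complex.cpow_one, smul_eq_mul, mul_inv, Complex.ofReal_mul,
      Complex.ofReal_inv w]
    field_simp
  have h3 : IntegrableOn (fun w : ℝ => (((w * (1 + w))⁻¹ : ℝ) : ℂ) * ((w⁻¹ : ℝ) : ℂ) ^ (-s))
      (Set.Ioi 0) := IntegrableOn.congr_fun h1.1 h2 measurableSet_Ioi
  have h4 : ∫ w in Set.Ioi (0 : ℝ), (((w * (1 + w))⁻¹ : ℝ) : ℂ) * ((w⁻¹ : ℝ) : ℂ) ^ (-s)
      = Complex.Gamma s * Complex.Gamma (1 - s) := by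
    rw [← h1.2]
    exact (setIntegral_congr_fun measurableSet_Ioi h2).symm
  have := hasMellin_superposition (μ := volume.restrict (Set.Ioi (0 : ℝ)))
    (φ := fun x : ℝ => (((1 + x)⁻¹ : ℝ) : ℂ)) (h := fun w : ℝ => (((w * (1 + w))⁻¹ : ℝ) : ℂ))
    (a := fun w => w⁻¹) (by fun_prop) (by fun_prop) measurable_inv
    ((ae_restrict_mem measurableSet_Ioi).mono fun w hw => inv_pos.2 hw) h1 h3 h4
  refine hasMellin_congr this fun x hx => ?_
  rw [meanLogRatio_inv hx, ← integral_complex_ofReal]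
  simp only [Complex.ofReal_mul]

theorem integrableOn_inv_add_mul_inv_one_add {x : ℝ} (hx : 0 < x) :
    IntegrableOn (fun w : ℝ => (x + w)⁻¹ * (1 + w)⁻¹) (Set.Ioi 0) := by
  have hy : 0 < min x 1 := by positivity
  have h1 : IntegrableOn (fun w : ℝ => (min x 1 + w) ^ (-2 : ℝ)) (Set.Ioi 0) := by
    have := integrableOn_add_rpow_Ioi_of_lt (a := -2) (c := 0) (m := min x 1) (by norm_num)
      (by linarith)
    simpa only [add_comm] using this
  refine Integrable.mono' h1 (by fun_prop) ?_
  refine (ae_restrict_iff' measurableSet_Ioi).2 (Filter.Eventually.of_forall fun w hw => ?_)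
  have hw : 0 < w := hw
  rw [Real.norm_of_nonneg (by positivity), Real.rpow_neg (by positivity), Real.rpow_two, sq,
    mul_inv]
  gcongr
  · exact min_le_left _ _
  · exact min_le_right _ _

theorem integrableOn_meanLogRatio {c : ℝ} (hc : 0 < c) :
    IntegrableOn (fun w : ℝ => c / ((1 + c * w) * (1 + w))) (Set.Ioi 0) := by
  refine (integrableOn_inv_add_mul_inv_one_add (x := c⁻¹) (by positivity)).congr_fun
    (fun w hw => ?_) measurableSet_Ioi
  have hw : 0 < w := hw
  have : 1 + c * w ≠ 0 := by positivity
  simp only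
  field_simp

theorem meanLogRatio_nonneg {c : ℝ} (hc : 0 ≤ c) : 0 ≤ meanLogRatio c :=
  setIntegral_nonneg measurableSet_Ioi fun w hw => by
    have hw : 0 < w := hw
    positivity

theorem meanLogRatio_strictMonoOn : StrictMonoOn meanLogRatio (Set.Ioi 0) := by
  intro c hc c' hc' hcc
  have hc : 0 < c := hc
  have hc' : 0 < c' := hc'
  have key : 0 < ∫ w in Set.Ioi (0 : ℝ),
      (c' / ((1 + c' * w) * (1 + w)) - c / ((1 + c * w) * (1 + w))) := by
    have hpos : ∀ w ∈ Set.Ioi (0 : ℝ),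
        0 < c' / ((1 + c' * w) * (1 + w)) - c / ((1 + c * w) * (1 + w)) := by
      intro w hw
      have hw : 0 < w := hw
      rw [sub_pos, div_lt_div_iff₀ (by positivity) (by positivity)]
      nlinarith [mul_pos (sub_pos.2 hcc) (show 0 < 1 + w by positivity)]
    rw [setIntegral_pos_iff_support_of_nonneg_ae]
    · refine lt_of_lt_of_le ?_
        (measure_mono (s := Set.Ioi (0 : ℝ)) fun w hw => ⟨(hpos w hw).ne', hw⟩)
      simp
    · exact (ae_restrict_iff' measurableSet_Ioi).2
        (Filter.Eventually.of_forall fun w hw => (hpos w hw).le)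
    · exact (integrableOn_meanLogRatio hc').sub (integrableOn_meanLogRatio hc)
  rw [integral_sub (integrableOn_meanLogRatio hc') (integrableOn_meanLogRatio hc)] at key
  exact sub_pos.1 key

@[fun_prop]
theorem measurable_meanLogRatio : Measurable meanLogRatio := by
  unfold meanLogRatio
  refine StronglyMeasurable.measurable ?_
  refine StronglyMeasurable.integral_prod_right (f := fun c w => c / ((1 + c * w) * (1 + w))) ?_
  exact Measurable.stronglyMeasurable (by unfold Function.uncurry; fun_prop)

theorem continuousOn_meanLogRatio : ContinuousOn meanLogRatio (Set.Ioi 0) := by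
  intro c hc
  have hc : 0 < c := hc
  refine ContinuousAt.continuousWithinAt ?_
  refine continuousAt_of_dominated (bound := fun w => 2 * c / ((1 + 2 * c * w) * (1 + w)))
    (F := fun c w => c / ((1 + c * w) * (1 + w))) ?_ ?_
    (integrableOn_meanLogRatio (by positivity)) ?_
  · exact Filter.Eventually.of_forall fun c => Measurable.aestronglyMeasurable (by fun_prop)
  · filter_upwards [Ioo_mem_nhds (show 0 < c by positivity) (show c < 2 * c by linarith)]
      with x hx
    refine (ae_restrict_iff' measurableSet_Ioi).2 (Filter.Eventually.of_forall fun w hw => ?_)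
    have hw : 0 < w := hw
    have hx0 : 0 < x := hx.1
    rw [Real.norm_of_nonneg (by positivity), div_le_div_iff₀ (by positivity) (by positivity)]
    nlinarith [mul_nonneg (sub_pos.2 hx.2).le (show 0 ≤ 1 + w by positivity)]
  · refine (ae_restrict_iff' measurableSet_Ioi).2 (Filter.Eventually.of_forall fun w hw => ?_)
    have hw : 0 < w := hw
    refine ContinuousAt.div (by fun_prop) (by fun_prop) (by positivity)

/-! ### The Meijer G-functions and the series -/

/-- The growth bound comes from `(c w) ^ (3/4) ≤ 1 + c w`. The exponent `1/4` keeps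
`v ↦ meanLogRatio (z / v ^ 2)` integrable at `0`. -/
theorem exists_meanLogRatio_le :
    ∃ K : ℝ, 0 ≤ K ∧ ∀ c : ℝ, 0 < c → meanLogRatio c ≤ K * c ^ (1 / 4 : ℝ) := by
  have h := (hasMellin_inv_one_add (s := ((1 / 4 : ℝ) : ℂ)) (by norm_num) (by norm_num)).1
  have hint : IntegrableOn (fun w : ℝ => w ^ (-(3 / 4) : ℝ) * (1 + w)⁻¹) (Set.Ioi 0) := by
    refine IntegrableOn.congr_fun h.norm (fun w hw => ?_) measurableSet_Ioi
    have hw : 0 < w := hw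
    rw [norm_smul, Complex.norm_cpow_eq_rpow_re_of_pos hw, Complex.norm_real,
      Real.norm_of_nonneg (by positivity)]
    congr 2
    simp only [Complex.sub_re, Complex.ofReal_re, Complex.one_re]; norm_num
  refine ⟨∫ w in Set.Ioi (0 : ℝ), w ^ (-(3 / 4) : ℝ) * (1 + w)⁻¹,
    setIntegral_nonneg measurableSet_Ioi fun w hw => ?_, fun c hc => ?_⟩
  · have hw : 0 < w := hw
    positivity
  · rw [← integral_mul_const]
    refine setIntegral_mono_on (integrableOn_meanLogRatio hc) (hint.mul_const _)
      measurableSet_Ioi fun w hw => ?_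
    have hw : 0 < w := hw
    have h1 : (c * w) ^ (3 / 4 : ℝ) ≤ 1 + c * w := by
      calc (c * w) ^ (3 / 4 : ℝ) ≤ (1 + c * w) ^ (3 / 4 : ℝ) := by gcongr; linarith
        _ ≤ (1 + c * w) ^ (1 : ℝ) :=
          Real.rpow_le_rpow_of_exponent_le (by linarith [mul_pos hc hw]) (by norm_num)
        _ = 1 + c * w := Real.rpow_one _
    have h2 : c = c ^ (1 / 4 : ℝ) * c ^ (3 / 4 : ℝ) := by
      rw [← Real.rpow_add hc]; norm_num
    calc c / ((1 + c * w) * (1 + w)) ≤ c / ((c * w) ^ (3 / 4 : ℝ) * (1 + w)) := by gcongr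
      _ = w ^ (-(3 / 4) : ℝ) * (1 + w)⁻¹ * c ^ (1 / 4 : ℝ) := by
        rw [Real.mul_rpow hc.le hw.le, Real.rpow_neg hw.le]
        nth_rewrite 1 [h2]
        have : c ^ (3 / 4 : ℝ) ≠ 0 := by positivity
        field_simp

theorem integrableOn_meanLogRatio_div_sq {z : ℝ} (hz : 0 < z) :
    IntegrableOn (fun v : ℝ => meanLogRatio (z / v ^ 2)) (Set.Ioc 0 1) := by
  obtain ⟨K, hK, hb⟩ := exists_meanLogRatio_le
  have h1 : IntegrableOn (fun v : ℝ => K * z ^ (1 / 4 : ℝ) * v ^ (-(1 / 2) : ℝ)) (Set.Ioc 0 1) := by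
    refine Integrable.const_mul ?_ _
    have := intervalIntegral.intervalIntegrable_rpow' (a := 0) (b := 1) (r := -(1 / 2))
      (by norm_num)
    rwa [intervalIntegrable_iff_integrableOn_Ioc_of_le zero_le_one] at this
  refine Integrable.mono' h1 (Measurable.aestronglyMeasurable (by fun_prop)) ?_
  refine (ae_restrict_iff' measurableSet_Ioc).2 (Filter.Eventually.of_forall fun v hv => ?_)
  have hv : 0 < v := hv.1
  rw [Real.norm_of_nonneg (meanLogRatio_nonneg (by positivity))]
  refine (hb _ (by positivity)).trans_eq ?_
  rw [Real.div_rpow hz.le (by positivity), ← Real.rpow_natCast v 2, ← Real.rpow_mul hv.le,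
    Real.rpow_neg hv.le]
  norm_num
  ring

/-- The average of `v ^ k * meanLogRatio (z / v ^ 2)` over the unit interval: half of the
Meijer G-function of the `k`-th term of the series. -/
def powerMoment (k : ℕ) (z : ℝ) : ℝ :=
  ∫ v in Set.Ioc (0 : ℝ) 1, v ^ k * meanLogRatio (z / v ^ 2)

theorem continuousAt_powerMoment (k : ℕ) {z : ℝ} (hz : 0 < z) :
    ContinuousAt (powerMoment k) z := by
  refine continuousAt_of_dominated (bound := fun v => meanLogRatio (2 * z / v ^ 2))
    (F := fun z v => v ^ k * meanLogRatio (z / v ^ 2)) ?_ ?_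
    (integrableOn_meanLogRatio_div_sq (by positivity)) ?_
  · exact Filter.Eventually.of_forall fun z => Measurable.aestronglyMeasurable (by fun_prop)
  · filter_upwards [Ioo_mem_nhds (show 0 < z by positivity) (show z < 2 * z by linarith)]
      with x hx
    refine (ae_restrict_iff' measurableSet_Ioc).2 (Filter.Eventually.of_forall fun v hv => ?_)
    have hv0 : 0 < v := hv.1
    have hx0 : 0 < x := hx.1
    have h0 := meanLogRatio_nonneg (show 0 ≤ x / v ^ 2 by positivity)
    rw [Real.norm_of_nonneg (by positivity)]
    calc v ^ k * meanLogRatio (x / v ^ 2) ≤ 1 * meanLogRatio (x / v ^ 2) := by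
          gcongr
          exact pow_le_one₀ hv0.le hv.2
      _ = meanLogRatio (x / v ^ 2) := one_mul _
      _ ≤ meanLogRatio (2 * z / v ^ 2) := by
        refine meanLogRatio_strictMonoOn.monotoneOn ?_ ?_ ?_
        · exact Set.mem_Ioi.2 (by positivity)
        · exact Set.mem_Ioi.2 (by positivity)
        · have := hx.2.le
          gcongr
  · refine (ae_restrict_iff' measurableSet_Ioc).2 (Filter.Eventually.of_forall fun v hv => ?_)
    have hv : 0 < v := hv.1
    refine ContinuousAt.mul continuousAt_const ?_
    have h1 : ContinuousAt meanLogRatio (z / v ^ 2) :=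
      continuousOn_meanLogRatio.continuousAt (Ioi_mem_nhds (div_pos hz (by positivity)))
    exact ContinuousAt.comp (g := meanLogRatio) (f := fun z : ℝ => z / v ^ 2) h1 (by fun_prop)

theorem integral_Ioc_cpow_sq (k : ℕ) {s : ℂ} (hk : s.re < ((k : ℝ) + 1) / 2) :
    IntegrableOn (fun v : ℝ => ((v ^ k : ℝ) : ℂ) * ((v ^ 2 : ℝ) : ℂ) ^ (-s)) (Set.Ioc 0 1) ∧
    ∫ v in Set.Ioc (0 : ℝ) 1, ((v ^ k : ℝ) : ℂ) * ((v ^ 2 : ℝ) : ℂ) ^ (-s)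
      = ((k : ℂ) + 1 - 2 * s)⁻¹ := by
  have hre : -1 < ((k : ℂ) - 2 * s).re := by
    simp only [Complex.sub_re, Complex.natCast_re, Complex.mul_re, Complex.re_ofNat,
      Complex.im_ofNat, zero_mul, sub_zero]
    linarith
  have h1 : ∀ v ∈ Set.Ioc (0 : ℝ) 1, (v : ℂ) ^ ((k : ℂ) - 2 * s)
      = ((v ^ k : ℝ) : ℂ) * ((v ^ 2 : ℝ) : ℂ) ^ (-s) := by
    intro v hv
    have hv0 : 0 < v := hv.1
    have hne : (v : ℂ) ≠ 0 := by exact_mod_cast hv0.ne'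
    rw [sub_eq_add_neg, Complex.cpow_add _ _ hne, Complex.cpow_natCast, Complex.ofReal_pow,
      sq, Complex.ofReal_mul, Complex.mul_cpow_ofReal_nonneg hv0.le hv0.le,
      ← Complex.cpow_add _ _ hne]
    congr 2
    ring
  constructor
  · refine IntegrableOn.congr_fun ?_ h1 measurableSet_Ioc
    have := intervalIntegral.intervalIntegrable_cpow' (a := 0) (b := 1) hre
    rwa [intervalIntegrable_iff_integrableOn_Ioc_of_le zero_le_one] at this
  · rw [← setIntegral_congr_fun measurableSet_Ioc h1, ← intervalIntegral.integral_of_le zero_le_one,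
      integral_cpow (Or.inl hre)]
    have hne : (k : ℂ) - 2 * s + 1 ≠ 0 := fun h => by
      have := congrArg Complex.re h
      simp only [Complex.add_re, Complex.one_re, Complex.zero_re] at this
      linarith
    rw [Complex.ofReal_one, Complex.one_cpow, Complex.ofReal_zero, Complex.zero_cpow hne, sub_zero,
      one_div]
    congr 1; ring

theorem hasMellin_powerMoment_inv (k : ℕ) {s : ℂ} (hs0 : 0 < s.re) (hs : s.re < 1)
    (hk : s.re < ((k : ℝ) + 1) / 2) :
    HasMellin (fun x : ℝ => (powerMoment k x⁻¹ : ℂ)) s (((k : ℂ) + 1 - 2 * s)⁻¹ *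
      (Complex.Gamma s * Complex.Gamma (1 - s) * (Complex.Gamma s * Complex.Gamma (1 - s)))) := by
  obtain ⟨h1, h2⟩ := integral_Ioc_cpow_sq k hk
  have := hasMellin_superposition (μ := volume.restrict (Set.Ioc (0 : ℝ) 1))
    (φ := fun x : ℝ => (meanLogRatio x⁻¹ : ℂ)) (h := fun v : ℝ => ((v ^ k : ℝ) : ℂ))
    (a := fun v => v ^ 2) (by fun_prop) (by fun_prop) (by fun_prop)
    ((ae_restrict_mem measurableSet_Ioc).mono fun v hv => pow_pos hv.1 2)
    (hasMellin_meanLogRatio_inv hs0 hs) h1 h2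
  refine hasMellin_congr this fun x hx => ?_
  unfold powerMoment
  rw [← integral_complex_ofReal]
  simp only [Complex.ofReal_mul]
  congr 1
  ext v
  rw [mul_inv, div_eq_mul_inv, mul_comm x⁻¹]

theorem norm_sq_sin_mul_pi (σ t : ℝ) : Real.sin (Real.pi * σ) ^ 2 + (Real.pi * t) ^ 2
    ≤ ‖Complex.sin (Real.pi * ((σ : ℂ) + t * Complex.I))‖ ^ 2 := by
  have h : (Real.pi : ℂ) * ((σ : ℂ) + t * Complex.I)
      = ((Real.pi * σ : ℝ) : ℂ) + ((Real.pi * t : ℝ) : ℂ) * Complex.I := by push_cast; ring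
  rw [h, Complex.sin_add_mul_I, Complex.sq_norm, Complex.normSq_apply]
  set x := Real.pi * σ
  set y := Real.pi * t
  have hre : (Complex.sin (x : ℂ) * Complex.cosh (y : ℂ)
      + Complex.cos (x : ℂ) * Complex.sinh (y : ℂ) * Complex.I)
      = ((Real.sin x * Real.cosh y : ℝ) : ℂ)
        + ((Real.cos x * Real.sinh y : ℝ) : ℂ) * Complex.I := by
    push_cast; ring
  rw [hre]
  simp only [Complex.add_re, Complex.ofReal_re, Complex.mul_re, Complex.I_re, mul_zero,
    Complex.ofReal_im, Complex.I_im, mul_one, sub_self, add_zero, Complex.add_im, Complex.mul_im,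
    zero_add]
  have h1 := Real.cosh_sq y
  have h2 := Real.sin_sq_add_cos_sq x
  have h3 : y ^ 2 ≤ Real.sinh y ^ 2 := by
    rw [sq_le_sq, Real.abs_sinh]
    exact Real.self_le_sinh_iff.2 (abs_nonneg y)
  nlinarith

/-- By the reflection formula the transform is `(π / sin (π s)) ^ 2 / (k + 1 - 2 s)`, which decays
at least quadratically along vertical lines in the strip. -/
theorem verticalIntegrable_powerMoment (k : ℕ) {σ : ℝ} (hs0 : 0 < σ) (hs : σ < 1)
    (hk : σ < ((k : ℝ) + 1) / 2) :
    Integrable fun t : ℝ => (((k : ℂ) + 1 - 2 * ((σ : ℂ) + t * Complex.I))⁻¹ *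
      (Complex.Gamma ((σ : ℂ) + t * Complex.I) * Complex.Gamma (1 - ((σ : ℂ) + t * Complex.I)) *
      (Complex.Gamma ((σ : ℂ) + t * Complex.I) *
        Complex.Gamma (1 - ((σ : ℂ) + t * Complex.I))))) := by
  simp_rw [Complex.Gamma_mul_Gamma_one_sub]
  have hsin : 0 < Real.sin (Real.pi * σ) := by
    apply Real.sin_pos_of_pos_of_lt_pi
    · positivity
    · nlinarith [Real.pi_pos]
  set m : ℝ := min (Real.sin (Real.pi * σ) ^ 2) (Real.pi ^ 2) with hm
  have hmpos : 0 < m := by positivity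
  have hδ : 0 < (k : ℝ) + 1 - 2 * σ := by linarith
  have hb : Integrable fun t : ℝ => ((k : ℝ) + 1 - 2 * σ)⁻¹ * (Real.pi ^ 2 * m⁻¹) * (1 + t ^ 2)⁻¹ :=
    integrable_inv_one_add_sq.const_mul _
  refine Integrable.mono' hb (Measurable.aestronglyMeasurable (by fun_prop)) ?_
  refine Filter.Eventually.of_forall fun t => ?_
  have h1 := norm_sq_sin_mul_pi σ t
  have h2 : m * (1 + t ^ 2) ≤ ‖Complex.sin (Real.pi * ((σ : ℂ) + t * Complex.I))‖ ^ 2 := by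
    refine le_trans ?_ h1
    rw [mul_pow, mul_add, mul_one]
    gcongr
    · exact min_le_left _ _
    · exact min_le_right _ _
  have h3 : (k : ℝ) + 1 - 2 * σ ≤ ‖(k : ℂ) + 1 - 2 * ((σ : ℂ) + t * Complex.I)‖ := by
    refine le_trans (le_of_eq ?_) (Complex.re_le_norm _)
    simp
  rw [norm_mul, norm_inv, norm_mul, norm_div, Complex.norm_real, Real.norm_of_nonneg Real.pi_pos.le]
  have h4 : Real.pi / ‖Complex.sin (Real.pi * ((σ : ℂ) + t * Complex.I))‖ *
      (Real.pi / ‖Complex.sin (Real.pi * ((σ : ℂ) + t * Complex.I))‖)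
      = Real.pi ^ 2 * (‖Complex.sin (Real.pi * ((σ : ℂ) + t * Complex.I))‖ ^ 2)⁻¹ := by
    rw [← div_eq_mul_inv, sq, sq]; field_simp
  rw [h4, mul_assoc, mul_assoc, ← mul_inv]
  gcongr

theorem meijerIntegrand_eq (k : ℕ) (z s : ℂ) (hk : s.re < ((k : ℝ) + 1) / 2) :
    meijerIntegrand 3 2 ![1, 1, 1 + ((k : ℂ) + 1) / 2] ![1, 1, ((k : ℂ) + 1) / 2] z s =
      2 * (z ^ s * (((k : ℂ) + 1 - 2 * s)⁻¹ * (Complex.Gamma s * Complex.Gamma (1 - s) *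
        (Complex.Gamma s * Complex.Gamma (1 - s))))) := by
  have hre : 0 < (((k : ℂ) + 1) / 2 - s).re := by
    have : (((k : ℂ) + 1) / 2).re = ((k : ℝ) + 1) / 2 := by simp
    rw [Complex.sub_re, this]; linarith
  have hne : ((k : ℂ) + 1) / 2 - s ≠ 0 := fun h => by simp [h] at hre
  have hG : Complex.Gamma (((k : ℂ) + 1) / 2 - s) ≠ 0 := Complex.Gamma_ne_zero_of_re_pos hre
  have h2 : ((k : ℂ) + 1 - 2 * s) = 2 * (((k : ℂ) + 1) / 2 - s) := by ring
  rw [h2]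
  generalize ((k : ℂ) + 1) / 2 = β at hne hG
  have h1 : Complex.Gamma (1 + β - s) = (β - s) * Complex.Gamma (β - s) := by
    rw [← Complex.Gamma_add_one _ hne]; congr 1; ring
  simp only [meijerIntegrand, Fin.prod_univ_three]
  have e1 : (![1, 1, 1 + β] : Fin 3 → ℂ) 2 = 1 + β := rfl
  have e2 : (![1, 1, β] : Fin 3 → ℂ) 2 = β := rfl
  norm_num [h1, e1, e2]
  field_simp

/-- The Meijer G-functions of the series, by Mellin inversion. -/
theorem meijerG_eq_powerMoment (k : ℕ) {z : ℝ} (hz : 0 < z) :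
    meijerG 3 2 ![1, 1, 1 + ((k : ℂ) + 1) / 2] ![1, 1, ((k : ℂ) + 1) / 2] (z : ℂ)
      = 2 * (powerMoment k z : ℂ) := by
  have hβ : (((k : ℂ) + 1) / 2).re = ((k : ℝ) + 1) / 2 := by simp
  have hex : ∃ c : ℝ, IsSeparatingLine 3 2 ![1, 1, 1 + ((k : ℂ) + 1) / 2]
      ![1, 1, ((k : ℂ) + 1) / 2] c := by
    refine ⟨1 / 4, ?_, ?_⟩
    · intro j _
      fin_cases j
      · simp; norm_num
      · simp; norm_num
      · simp only [Fin.reduceFinMk, Matrix.cons_val, hβ]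
        have : (0 : ℝ) ≤ k := Nat.cast_nonneg k
        linarith
    · intro j hj
      fin_cases j
      · simp
      · simp
      · simp at hj
  unfold meijerG
  rw [dif_pos hex]
  obtain ⟨hc1, hc2⟩ := hex.choose_spec
  set σ := hex.choose
  have hs : σ < 1 := by simpa using hc1 0 (by simp)
  have hs0 : 0 < σ := by simpa using hc2 0 (by simp)
  have hk : σ < ((k : ℝ) + 1) / 2 := by
    have := hc1 2 (by simp)
    simpa only [Matrix.cons_val, hβ] using this
  have hre : ∀ t : ℝ, ((σ : ℂ) + t * Complex.I).re = σ := by intro t; simp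
  have hmel : ∀ t : ℝ,
      mellin (fun x : ℝ => (powerMoment k x⁻¹ : ℂ)) ((σ : ℂ) + t * Complex.I) = _ :=
    fun t => (hasMellin_powerMoment_inv k (s := (σ : ℂ) + t * Complex.I) (by rwa [hre])
      (by rwa [hre]) (by rwa [hre])).2
  have hinv := mellinInv_mellin_eq σ (fun x : ℝ => (powerMoment k x⁻¹ : ℂ)) (x := z⁻¹)
    (by positivity)
    (hasMellin_powerMoment_inv k (s := (σ : ℂ)) (by simpa) (by simpa) (by simpa)).1
    (by
      unfold Complex.VerticalIntegrable
      simp_rw [hmel]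
      exact verticalIntegrable_powerMoment k hs0 hs hk)
    (by
      refine Complex.continuous_ofReal.continuousAt.comp ?_
      refine ContinuousAt.comp (g := powerMoment k) ?_ (continuousAt_inv₀ (by positivity))
      rw [inv_inv]
      exact continuousAt_powerMoment k hz)
  unfold mellinInv at hinv
  simp_rw [hmel] at hinv
  rw [inv_inv] at hinv
  have hz' : (z : ℂ).arg ≠ Real.pi := by
    rw [Complex.arg_ofReal_of_nonneg hz.le]; exact Real.pi_pos.ne
  have h1 : ∀ t : ℝ, ((z⁻¹ : ℝ) : ℂ) ^ (-((σ : ℂ) + t * Complex.I))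
      = (z : ℂ) ^ ((σ : ℂ) + t * Complex.I) := by
    intro t
    rw [Complex.ofReal_inv, Complex.inv_cpow _ _ hz', Complex.cpow_neg, inv_inv]
  simp_rw [h1, smul_eq_mul] at hinv
  have h2 : ∀ t : ℝ, _ := fun t : ℝ =>
    meijerIntegrand_eq k z ((σ : ℂ) + t * Complex.I) (by rwa [hre])
  simp_rw [h2]
  rw [integral_const_mul, ← hinv, Complex.real_smul]
  push_cast
  ring

/-- The sum of the series, by expanding `exp (-(A * v))` and integrating term by term. -/
theorem hasSum_powerMoment (A : ℝ) {z : ℝ} (hz : 0 < z) :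
    HasSum (fun k : ℕ => (-1) ^ k * A ^ (k + 1) / (k.factorial : ℝ) * powerMoment k z)
      (∫ v in Set.Ioc (0 : ℝ) 1, A * Real.exp (-(A * v)) * meanLogRatio (z / v ^ 2)) := by
  have hi := integrableOn_meanLogRatio_div_sq hz
  set F : ℕ → ℝ → ℝ := fun k v =>
    (-1) ^ k * A ^ (k + 1) / (k.factorial : ℝ) * (v ^ k * meanLogRatio (z / v ^ 2)) with hF
  have hbase : ∀ k : ℕ, IntegrableOn (fun v : ℝ => v ^ k * meanLogRatio (z / v ^ 2))
      (Set.Ioc 0 1) := by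
    intro k
    refine Integrable.mono' hi (Measurable.aestronglyMeasurable (by fun_prop)) ?_
    refine (ae_restrict_iff' measurableSet_Ioc).2 (Filter.Eventually.of_forall fun v hv => ?_)
    have hv0 : 0 < v := hv.1
    have h0 := meanLogRatio_nonneg (show 0 ≤ z / v ^ 2 by positivity)
    rw [Real.norm_of_nonneg (by positivity)]
    exact mul_le_of_le_one_left h0 (pow_le_one₀ hv0.le hv.2)
  have hle : ∀ k : ℕ, powerMoment k z ≤ powerMoment 0 z := by
    intro k
    refine setIntegral_mono_on (hbase k) (hbase 0) measurableSet_Ioc fun v hv => ?_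
    have hv0 : 0 < v := hv.1
    have h0 := meanLogRatio_nonneg (show 0 ≤ z / v ^ 2 by positivity)
    rw [pow_zero]
    gcongr
    exact pow_le_one₀ hv0.le hv.2
  have hnorm : ∀ k : ℕ, ∫ v in Set.Ioc (0 : ℝ) 1, ‖F k v‖
      = |A| ^ (k + 1) / (k.factorial : ℝ) * powerMoment k z := by
    intro k
    unfold powerMoment
    rw [← integral_const_mul]
    refine setIntegral_congr_fun measurableSet_Ioc fun v hv => ?_
    have hv0 : 0 < v := hv.1
    have h0 := meanLogRatio_nonneg (show 0 ≤ z / v ^ 2 by positivity)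
    simp only [hF, norm_mul, norm_div, norm_pow, norm_neg, norm_one, one_pow, one_mul,
      Real.norm_eq_abs, Nat.abs_cast, abs_of_nonneg h0, abs_of_pos hv0]
  have hsum := hasSum_integral_of_summable_integral_norm (F := F)
    (μ := volume.restrict (Set.Ioc (0 : ℝ) 1)) (fun k => (hbase k).const_mul _) (by
      simp_rw [hnorm]
      have h1 : Summable fun k : ℕ => |A| * (|A| ^ k / (k.factorial : ℝ)) * powerMoment 0 z :=
        ((Real.summable_pow_div_factorial |A|).mul_left |A|).mul_right _
      refine Summable.of_nonneg_of_le (fun k => ?_) (fun k => ?_) h1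
      · have : 0 ≤ powerMoment k z := setIntegral_nonneg measurableSet_Ioc fun v hv => by
          have hv0 : 0 < v := hv.1
          have h0 := meanLogRatio_nonneg (show 0 ≤ z / v ^ 2 by positivity)
          positivity
        positivity
      · calc |A| ^ (k + 1) / (k.factorial : ℝ) * powerMoment k z
            = |A| * (|A| ^ k / (k.factorial : ℝ)) * powerMoment k z := by ring
          _ ≤ _ := by gcongr; exact hle k)
  have hterm : ∀ k : ℕ, ∫ v in Set.Ioc (0 : ℝ) 1, F k v
      = (-1) ^ k * A ^ (k + 1) / (k.factorial : ℝ) * powerMoment k z :=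
    fun k => integral_const_mul _ _
  simp_rw [hterm] at hsum
  suffices hlim : ∫ v in Set.Ioc (0 : ℝ) 1, A * Real.exp (-(A * v)) * meanLogRatio (z / v ^ 2)
      = ∫ v in Set.Ioc (0 : ℝ) 1, ∑' k, F k v by rw [hlim]; exact hsum
  refine setIntegral_congr_fun measurableSet_Ioc fun v hv => ?_
  have h1 : HasSum (fun k : ℕ => (-(A * v)) ^ k / (k.factorial : ℝ)) (Real.exp (-(A * v))) := by
    rw [Real.exp_eq_exp_ℝ]
    exact NormedSpace.expSeries_div_hasSum_exp _
  have h2 := (h1.mul_left A).mul_right (meanLogRatio (z / v ^ 2))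
  refine (h2.tsum_eq.symm).trans (tsum_congr fun k => ?_)
  simp only [hF]
  rw [neg_pow, mul_pow]
  ring

/-! ### Exponential variables and polar coordinates -/

/-- The standard exponential distribution, by its density on `(0, ∞)`. -/
def stdExp : Measure ℝ :=
  (volume.restrict (Set.Ioi 0)).withDensity fun t => ENNReal.ofReal (Real.exp (-t))

theorem lintegral_stdExp (F : ℝ → ENNReal) :
    ∫⁻ t, F t ∂stdExp = ∫⁻ t in Set.Ioi 0, ENNReal.ofReal (Real.exp (-t)) * F t := by
  unfold stdExp
  rw [lintegral_withDensity_eq_lintegral_mul_non_measurable _ (by fun_prop)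
    (Filter.Eventually.of_forall fun t => ENNReal.ofReal_lt_top)]
  rfl

theorem lintegral_exp_neg_mul {b : ℝ} (hb : 0 < b) {a : ℝ} :
    ∫⁻ t in Set.Ioi a, ENNReal.ofReal (Real.exp (-(b * t)))
      = ENNReal.ofReal (Real.exp (-(b * a)) / b) := by
  have h : (fun t : ℝ => Real.exp (-(b * t))) = fun t : ℝ => Real.exp (-b * t) := by
    ext t; congr 1; ring
  rw [← ofReal_integral_eq_lintegral_ofReal, h, integral_exp_mul_Ioi (by linarith)]
  · congr 1
    rw [neg_div_neg_eq]
    congr 2; ring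
  · rw [h]
    exact integrableOn_exp_mul_Ioi (by linarith) a
  · exact Filter.Eventually.of_forall fun t => (Real.exp_pos _).le

theorem stdExp_Ioi {a : ℝ} (ha : 0 ≤ a) :
    stdExp (Set.Ioi a) = ENNReal.ofReal (Real.exp (-a)) := by
  unfold stdExp
  rw [withDensity_apply _ measurableSet_Ioi, Measure.restrict_restrict measurableSet_Ioi,
    Set.inter_eq_self_of_subset_left (Set.Ioi_subset_Ioi ha)]
  simpa using lintegral_exp_neg_mul one_pos (a := a)

theorem stdExp_Ici {a : ℝ} (ha : 0 ≤ a) :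
    stdExp (Set.Ici a) = ENNReal.ofReal (Real.exp (-a)) := by
  rw [← stdExp_Ioi ha]
  have : stdExp ≪ volume :=
    (withDensity_absolutelyContinuous _ _).trans Measure.restrict_le_self.absolutelyContinuous
  exact measure_congr (this.ae_eq Ioi_ae_eq_Ici.symm)

theorem ae_stdExp_pos : ∀ᵐ t ∂stdExp, 0 < t :=
  (withDensity_absolutelyContinuous _ _).ae_le (ae_restrict_mem measurableSet_Ioi)

instance : IsProbabilityMeasure stdExp := by
  constructor
  have h : stdExp (Set.Ioi 0) = stdExp Set.univ := by
    refine measure_congr ?_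
    filter_upwards [ae_stdExp_pos] with t ht
    exact eq_true ht
  rw [← h, stdExp_Ioi le_rfl]
  simp

theorem ofReal_log_one_add_eq_lintegral {c q : ℝ} (hc : 0 ≤ c) (hq : 0 ≤ q) :
    ENNReal.ofReal (Real.log (1 + c * q))
      = ∫⁻ w in Set.Ioi 0, ENNReal.ofReal (c / (1 + c * w)) * (Set.Iio q).indicator 1 w := by
  have h1 : ∀ w ∈ Set.Icc 0 q, HasDerivAt (fun w => Real.log (1 + c * w)) (c / (1 + c * w)) w := by
    intro w hw
    have h0 : 0 < 1 + c * w := by nlinarith [mul_nonneg hc hw.1]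
    have := (((hasDerivAt_id w).const_mul c).const_add 1).log h0.ne'
    simpa using this
  have hcont : ContinuousOn (fun w => c / (1 + c * w)) (Set.uIcc 0 q) := by
    rw [Set.uIcc_of_le hq]
    refine ContinuousOn.div (by fun_prop) (by fun_prop) fun w hw => ?_
    nlinarith [mul_nonneg hc hw.1]
  have h2 := intervalIntegral.integral_eq_sub_of_hasDerivAt (a := 0) (b := q)
    (fun w hw => h1 w (by rwa [Set.uIcc_of_le hq] at hw)) hcont.intervalIntegrable
  simp only [mul_zero, add_zero, Real.log_one, sub_zero] at h2
  have h3 : IntegrableOn (fun w => c / (1 + c * w)) (Set.Ioo 0 q) := by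
    have := hcont.intervalIntegrable (μ := volume)
    rw [intervalIntegrable_iff_integrableOn_Ioc_of_le hq] at this
    exact this.mono_set Set.Ioo_subset_Ioc_self
  rw [← h2, intervalIntegral.integral_of_le hq, integral_Ioc_eq_integral_Ioo,
    ofReal_integral_eq_lintegral_ofReal h3]
  · have h4 : ∀ w, ENNReal.ofReal (c / (1 + c * w)) * (Set.Iio q).indicator 1 w
        = (Set.Iio q).indicator (fun w => ENNReal.ofReal (c / (1 + c * w))) w := by
      intro w
      by_cases hw : w ∈ Set.Iio q <;> simp [hw]
    simp_rw [h4]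
    rw [lintegral_indicator measurableSet_Iio, Measure.restrict_restrict measurableSet_Iio,
      Set.inter_comm, Set.Ioi_inter_Iio]
  · refine (ae_restrict_iff' measurableSet_Ioo).2 (Filter.Eventually.of_forall fun w hw => ?_)
    have h0 : 0 < 1 + c * w := by nlinarith [mul_nonneg hc hw.1.le]
    exact div_nonneg hc h0.le

/-- For independent standard exponential `X`, `Y`, the ratio `X / Y` exceeds `w` with probability
`1 / (1 + w)`; this gives the mean of `log (1 + c * X / Y)`. -/
theorem lintegral_log_ratio {c : ℝ} (hc : 0 ≤ c) :
    ∫⁻ x, ∫⁻ y, ENNReal.ofReal (Real.log (1 + c * (x / y))) ∂stdExp ∂stdExp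
      = ENNReal.ofReal (meanLogRatio c) := by
  have hmeas : Measurable (Function.uncurry fun x y : ℝ =>
      ENNReal.ofReal (Real.log (1 + c * (x / y)))) := by unfold Function.uncurry; fun_prop
  rw [lintegral_lintegral_swap hmeas.aemeasurable]
  have hk : Measurable fun w : ℝ => ENNReal.ofReal (c / (1 + c * w)) := by fun_prop
  have hind : Measurable fun p : ℝ × ℝ × ℝ => (Set.Iio (p.1 / p.2.1)).indicator
      (1 : ℝ → ENNReal) p.2.2 := by
    have : (fun p : ℝ × ℝ × ℝ => (Set.Iio (p.1 / p.2.1)).indicator (1 : ℝ → ENNReal) p.2.2)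
        = Set.indicator {p : ℝ × ℝ × ℝ | p.2.2 < p.1 / p.2.1} 1 := by
      ext p; simp [Set.indicator_apply]
    rw [this]
    exact measurable_one.indicator (measurableSet_lt (by fun_prop) (by fun_prop))
  have hinner : ∀ y : ℝ, 0 < y →
      ∫⁻ x, ENNReal.ofReal (Real.log (1 + c * (x / y))) ∂stdExp
        = ∫⁻ w in Set.Ioi 0, ENNReal.ofReal (c / (1 + c * w)) *
          ENNReal.ofReal (Real.exp (-(w * y))) := by
    intro y hy
    have h1 : ∫⁻ x, ENNReal.ofReal (Real.log (1 + c * (x / y))) ∂stdExp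
        = ∫⁻ x, (∫⁻ w in Set.Ioi 0, ENNReal.ofReal (c / (1 + c * w)) *
          (Set.Iio (x / y)).indicator 1 w) ∂stdExp := by
      refine lintegral_congr_ae ?_
      filter_upwards [ae_stdExp_pos] with x hx
      exact ofReal_log_one_add_eq_lintegral hc (by positivity)
    rw [h1, lintegral_lintegral_swap]
    · refine setLIntegral_congr_fun measurableSet_Ioi fun w hw => ?_
      have hw : 0 < w := hw
      have h2 : ∀ x : ℝ, (Set.Iio (x / y)).indicator (1 : ℝ → ENNReal) w
          = (Set.Ioi (w * y)).indicator 1 x := by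
        intro x
        simp only [Set.indicator_apply, Set.mem_Iio, Set.mem_Ioi, lt_div_iff₀ hy, Pi.one_apply]
      simp_rw [h2]
      rw [lintegral_const_mul _ (measurable_one.indicator measurableSet_Ioi),
        lintegral_indicator_one measurableSet_Ioi, stdExp_Ioi (by positivity)]
    · refine Measurable.aemeasurable ?_
      unfold Function.uncurry
      exact (hk.comp measurable_snd).mul
        (hind.comp (measurable_fst.prodMk (measurable_const.prodMk measurable_snd)))
  calc ∫⁻ y, ∫⁻ x, ENNReal.ofReal (Real.log (1 + c * (x / y))) ∂stdExp ∂stdExp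
      = ∫⁻ y, (∫⁻ w in Set.Ioi 0, ENNReal.ofReal (c / (1 + c * w)) *
          ENNReal.ofReal (Real.exp (-(w * y)))) ∂stdExp := by
        refine lintegral_congr_ae ?_
        filter_upwards [ae_stdExp_pos] with y hy using hinner y hy
    _ = ∫⁻ w in Set.Ioi 0, (∫⁻ y, ENNReal.ofReal (c / (1 + c * w)) *
          ENNReal.ofReal (Real.exp (-(w * y))) ∂stdExp) := by
        refine lintegral_lintegral_swap (Measurable.aemeasurable ?_)
        unfold Function.uncurry
        fun_prop
    _ = ∫⁻ w in Set.Ioi 0, ENNReal.ofReal (c / ((1 + c * w) * (1 + w))) := by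
        refine setLIntegral_congr_fun measurableSet_Ioi fun w hw => ?_
        have hw : 0 < w := hw
        have h3 : ∀ y : ℝ, ENNReal.ofReal (Real.exp (-y)) * ENNReal.ofReal (Real.exp (-(w * y)))
            = ENNReal.ofReal (Real.exp (-((1 + w) * y))) := by
          intro y
          rw [← ENNReal.ofReal_mul (Real.exp_pos _).le, ← Real.exp_add]
          congr 2; ring
        rw [lintegral_const_mul _ (by fun_prop), lintegral_stdExp]
        simp_rw [h3]
        rw [lintegral_exp_neg_mul (by positivity), ← ENNReal.ofReal_mul (by positivity)]
        congr 1
        rw [mul_zero, neg_zero, Real.exp_zero]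
        field_simp
    _ = ENNReal.ofReal (meanLogRatio c) := by
        unfold meanLogRatio
        rw [ofReal_integral_eq_lintegral_ofReal]
        · rcases hc.eq_or_lt with rfl | hc
          · simp
          · exact integrableOn_meanLogRatio hc
        · refine (ae_restrict_iff' measurableSet_Ioi).2 (Filter.Eventually.of_forall fun w hw => ?_)
          have hw : 0 < w := hw
          simp only [Pi.zero_apply]
          positivity

/-- The substitution `t = b * r ^ 2`. -/
theorem lintegral_comp_mul_sq {b : ℝ} (hb : 0 < b) (F : ℝ → ENNReal) :
    ∫⁻ r in Set.Ioi 0, ENNReal.ofReal (2 * b * r) * F (b * r ^ 2) = ∫⁻ t in Set.Ioi 0, F t := by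
  have himg : (fun r : ℝ => b * r ^ 2) '' Set.Ioi 0 = Set.Ioi 0 := by
    ext t
    constructor
    · rintro ⟨r, hr, rfl⟩
      have hr : 0 < r := hr
      exact Set.mem_Ioi.2 (by positivity)
    · intro ht
      have ht : 0 < t := ht
      refine ⟨√(t / b), Real.sqrt_pos.2 (by positivity), ?_⟩
      simp only
      rw [Real.sq_sqrt (by positivity)]
      field_simp
  have hinj : Set.InjOn (fun r : ℝ => b * r ^ 2) (Set.Ioi 0) := by
    intro x hx y hy hxy
    have hx : 0 < x := hx
    have hy : 0 < y := hy
    have : x ^ 2 = y ^ 2 := mul_left_cancel₀ hb.ne' hxy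
    rwa [pow_left_inj₀ hx.le hy.le two_ne_zero] at this
  have h := lintegral_image_eq_lintegral_abs_deriv_mul (f := fun r : ℝ => b * r ^ 2)
    (f' := fun r => 2 * b * r) measurableSet_Ioi
    (fun x _ => by
      have := ((hasDerivAt_pow 2 x).const_mul b).hasDerivWithinAt (s := Set.Ioi 0)
      refine this.congr_deriv ?_
      push_cast; ring) hinj F
  rw [himg] at h
  rw [h]
  refine setLIntegral_congr_fun measurableSet_Ioi fun r hr => ?_
  have hr : 0 < r := hr
  rw [abs_of_nonneg (by positivity)]

theorem lintegral_Ioo_neg_pi_pi {F : ℝ → ENNReal} (hF : Function.Periodic F (2 * Real.pi)) :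
    ∫⁻ θ in Set.Ioo (-Real.pi) Real.pi, F θ = ∫⁻ θ in Set.Icc 0 (2 * Real.pi), F θ := by
  rw [setLIntegral_congr (Ioo_ae_eq_Ioc (μ := volume)),
    setLIntegral_congr (Ioc_ae_eq_Icc (μ := volume)).symm]
  have h := (isAddFundamentalDomain_Ioc Real.two_pi_pos (-Real.pi) volume).setLIntegral_eq
    (isAddFundamentalDomain_Ioc Real.two_pi_pos 0 volume) F
    (fun g x => hF.map_vadd_zmultiples g x)
  have h1 : -Real.pi + 2 * Real.pi = Real.pi := by ring
  rwa [h1, zero_add] at h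

theorem lintegral_complex_polar {F : ℂ → ENNReal} (hF : Measurable F) :
    ∫⁻ x, F x = ∫⁻ r in Set.Ioi 0, ENNReal.ofReal r *
      ∫⁻ θ in Set.Icc 0 (2 * Real.pi), F ((r : ℂ) * Complex.exp (θ * Complex.I)) := by
  have hsymm : ∀ p : ℝ × ℝ, Complex.polarCoord.symm p
      = (p.1 : ℂ) * Complex.exp ((p.2 : ℂ) * Complex.I) := by
    intro p
    rw [Complex.polarCoord_symm_apply, Complex.exp_mul_I]
    push_cast; ring
  rw [← Complex.lintegral_comp_polarCoord_symm]
  simp_rw [hsymm, smul_eq_mul]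
  have ht' : polarCoord.target = Set.Ioi (0 : ℝ) ×ˢ Set.Ioo (-Real.pi) Real.pi := rfl
  rw [ht', Measure.volume_eq_prod, ← Measure.prod_restrict, lintegral_prod _ (by fun_prop)]
  refine lintegral_congr fun r => ?_
  dsimp only
  rw [lintegral_const_mul _ (by fun_prop)]
  congr 1
  refine lintegral_Ioo_neg_pi_pi fun θ => ?_
  have : ((θ + 2 * Real.pi : ℝ) : ℂ) * Complex.I = θ * Complex.I + 2 * Real.pi * Complex.I := by
    push_cast; ring
  rw [this, Complex.exp_periodic]

theorem lintegral_complex_norm_sq {F : ℝ → ENNReal} (hF : Measurable F) :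
    ∫⁻ x : ℂ, F (‖x‖ ^ 2) = ENNReal.ofReal Real.pi * ∫⁻ t in Set.Ioi 0, F t := by
  rw [lintegral_complex_polar (by fun_prop), ← lintegral_comp_mul_sq one_pos F,
    ← lintegral_const_mul _ (by fun_prop)]
  refine setLIntegral_congr_fun measurableSet_Ioi fun r hr => ?_
  have hr : 0 < r := hr
  have h1 : ∀ θ : ℝ, ‖(r : ℂ) * Complex.exp (θ * Complex.I)‖ = r := by
    intro θ
    rw [norm_mul, Complex.norm_exp_ofReal_mul_I, mul_one, Complex.norm_real,
      Real.norm_of_nonneg hr.le]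
  simp_rw [h1]
  rw [setLIntegral_const, Real.volume_Icc, one_mul, mul_one, mul_comm (F _), ← mul_assoc,
    ← mul_assoc, ← ENNReal.ofReal_mul hr.le, ← ENNReal.ofReal_mul Real.pi_pos.le]
  congr 2; ring

/-! ### Circularly symmetric Gaussian variables -/

instance (v : ℝ≥0) : IsProbabilityMeasure (complexGaussian v) :=
  Measure.isProbabilityMeasure_map (by fun_prop)

theorem map_norm_sq_complexGaussian {v : ℝ≥0} (hv : 0 < v) :
    (complexGaussian v).map (fun h => ‖h‖ ^ 2) = stdExp.map (fun t => (v : ℝ) * t) := by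
  have hv2 : v / 2 ≠ 0 := by positivity
  have hvr : (0 : ℝ) < v := by exact_mod_cast hv
  have hden : ∀ x y : ℝ, gaussianPDF 0 (v / 2) x * gaussianPDF 0 (v / 2) y
      = ENNReal.ofReal ((Real.pi * v)⁻¹ * Real.exp (-(‖(x : ℂ) + y * Complex.I‖ ^ 2 / v))) := by
    intro x y
    unfold gaussianPDF
    rw [← ENNReal.ofReal_mul (gaussianPDFReal_nonneg _ _ _)]
    congr 1
    unfold gaussianPDFReal
    have h1 : ‖(x : ℂ) + y * Complex.I‖ ^ 2 = x ^ 2 + y ^ 2 := by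
      rw [Complex.sq_norm, Complex.normSq_add_mul_I]
    have h2 : (2 * Real.pi * ((v / 2 : ℝ≥0) : ℝ)) = Real.pi * v := by push_cast; ring
    have h3 : 2 * ((v / 2 : ℝ≥0) : ℝ) = v := by push_cast; ring
    rw [h1, h2, h3, sub_zero, sub_zero, mul_mul_mul_comm, ← mul_inv, ← Real.exp_add,
      Real.mul_self_sqrt (by positivity)]
    congr 2; ring
  refine Measure.ext_of_lintegral _ fun F hF => ?_
  rw [lintegral_map hF (by fun_prop), lintegral_map hF (by fun_prop)]
  unfold complexGaussian
  rw [lintegral_map (by fun_prop) (by fun_prop), gaussianReal_of_var_ne_zero _ hv2,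
    prod_withDensity (by fun_prop) (by fun_prop),
    lintegral_withDensity_eq_lintegral_mul _ (by fun_prop) (by fun_prop),
    ← Measure.volume_eq_prod]
  simp only [Pi.mul_apply, hden]
  have hG : Measurable fun u : ℝ =>
    ENNReal.ofReal ((Real.pi * v)⁻¹ * Real.exp (-(u / v))) * F u := by fun_prop
  have h4 := lintegral_complex_norm_sq hG
  rw [← Complex.volume_preserving_equiv_real_prod.symm.lintegral_comp (by fun_prop)] at h4
  have h5 : ∀ p : ℝ × ℝ, Complex.measurableEquivRealProd.symm p = (p.1 : ℂ) + p.2 * Complex.I := by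
    intro p
    rw [Complex.measurableEquivRealProd_symm_apply]
    exact Complex.mk_eq_add_mul_I _ _
  simp_rw [h5] at h4
  rw [h4, lintegral_stdExp, ← lintegral_const_mul _ hG]
  -- the substitution `u = v * t`
  have h6 := lintegral_image_eq_lintegral_abs_deriv_mul (f := fun t : ℝ => v * t)
    (f' := fun _ => (v : ℝ)) (s := Set.Ioi 0) measurableSet_Ioi
    (fun x _ => by simpa using ((hasDerivAt_id x).const_mul (v : ℝ)).hasDerivWithinAt)
    (fun x _ y _ h => mul_left_cancel₀ hvr.ne' h)
    (fun u => ENNReal.ofReal Real.pi *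
      (ENNReal.ofReal ((Real.pi * v)⁻¹ * Real.exp (-(u / v))) * F u))
  rw [Set.image_mul_left_Ioi hvr, mul_zero] at h6
  rw [h6]
  refine setLIntegral_congr_fun measurableSet_Ioi fun t _ => ?_
  rw [abs_of_pos hvr, ← mul_assoc, ← mul_assoc, ← ENNReal.ofReal_mul hvr.le,
    ← ENNReal.ofReal_mul (by positivity)]
  congr 2
  field_simp

theorem charFun_complexGaussian (v : ℝ≥0) (ξ : ℂ) :
    charFun (complexGaussian v) ξ = Complex.exp (-(v * ‖ξ‖ ^ 2 / 4 : ℝ)) := by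
  have h1 : ∀ p : ℝ × ℝ, Complex.exp ((inner ℝ ((p.1 : ℂ) + p.2 * Complex.I) ξ : ℝ) * Complex.I)
      = Complex.exp (p.1 * ξ.re * Complex.I) * Complex.exp (p.2 * ξ.im * Complex.I) := by
    intro p
    rw [← Complex.exp_add, ← add_mul]
    congr 2
    rw [Complex.inner]
    have : (starRingEnd ℂ) ((p.1 : ℂ) + p.2 * Complex.I) = (p.1 : ℂ) - p.2 * Complex.I := by
      simp [sub_eq_add_neg]
    rw [this]
    simp [mul_comm]
  rw [charFun_apply, complexGaussian, integral_map (by fun_prop)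
    (Measurable.aestronglyMeasurable (by fun_prop))]
  simp_rw [h1]
  rw [integral_prod_mul (fun x : ℝ => Complex.exp (x * ξ.re * Complex.I))
    (fun x : ℝ => Complex.exp (x * ξ.im * Complex.I))]
  have h2 : ∀ a : ℝ, ∫ x : ℝ, Complex.exp (x * a * Complex.I) ∂(gaussianReal 0 (v / 2))
      = Complex.exp (-((v : ℂ) * a ^ 2 / 4)) := by
    intro a
    have := charFun_gaussianReal (μ := 0) (v := v / 2) a
    rw [charFun_apply_real] at this
    simp_rw [mul_comm (_ : ℂ) (a : ℂ)]
    rw [this]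
    congr 1
    push_cast; ring
  rw [h2, h2, ← Complex.exp_add]
  congr 1
  have : ‖ξ‖ ^ 2 = ξ.re ^ 2 + ξ.im ^ 2 := by
    rw [Complex.sq_norm, Complex.normSq_apply]; ring
  rw [this]
  push_cast; ring

/-- Projecting i.i.d. circularly symmetric Gaussians on a unit vector gives the same law. -/
theorem map_sum_mul_pi_complexGaussian {ι : Type*} [Fintype ι] (v : ℝ≥0) (w : ι → ℂ)
    (hw : ∑ j, ‖w j‖ ^ 2 = 1) :
    (Measure.pi fun _ : ι => complexGaussian v).map (fun h => ∑ j, h j * w j)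
      = complexGaussian v := by
  have hm : Measurable fun h : ι → ℂ => ∑ j, h j * w j := by fun_prop
  have : IsProbabilityMeasure
      ((Measure.pi fun _ : ι => complexGaussian v).map (fun h => ∑ j, h j * w j)) :=
    Measure.isProbabilityMeasure_map hm.aemeasurable
  refine Measure.ext_of_charFun ?_
  ext ξ
  rw [charFun_apply, integral_map hm.aemeasurable (Measurable.aestronglyMeasurable (by fun_prop))]
  have h1 : ∀ h : ι → ℂ, Complex.exp ((inner ℝ (∑ j, h j * w j) ξ : ℝ) * Complex.I)
      = ∏ j, Complex.exp ((inner ℝ (h j) ((starRingEnd ℂ) (w j) * ξ) : ℝ) * Complex.I) := by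
    intro h
    rw [← Complex.exp_sum, ← Finset.sum_mul, sum_inner, Complex.ofReal_sum]
    congr 3
    ext j
    rw [Complex.inner, Complex.inner, map_mul]
    congr 2; ring
  simp_rw [h1]
  rw [integral_fintype_prod_eq_prod
    (fun j (x : ℂ) => Complex.exp ((inner ℝ x ((starRingEnd ℂ) (w j) * ξ) : ℝ) * Complex.I))]
  simp_rw [← charFun_apply, charFun_complexGaussian]
  rw [← Complex.exp_sum]
  congr 1
  rw [← Complex.ofReal_neg]
  simp_rw [← Complex.ofReal_neg]
  rw [← Complex.ofReal_sum]
  congr 1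
  rw [Finset.sum_neg_distrib]
  congr 1
  simp_rw [norm_mul, RCLike.norm_conj, mul_pow]
  calc ∑ j, (v : ℝ) * (‖w j‖ ^ 2 * ‖ξ‖ ^ 2) / 4 = (∑ j, ‖w j‖ ^ 2) * (v * ‖ξ‖ ^ 2 / 4) := by
        rw [Finset.sum_mul]
        exact Finset.sum_congr rfl fun j _ => by ring
    _ = v * ‖ξ‖ ^ 2 / 4 := by rw [hw, one_mul]

theorem ae_complexGaussian_ne_zero {v : ℝ≥0} (hv : 0 < v) : ∀ᵐ h ∂(complexGaussian v), h ≠ 0 := by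
  have hvr : (0 : ℝ) < v := by exact_mod_cast hv
  have h1 : ∀ᵐ s ∂((complexGaussian v).map fun h => ‖h‖ ^ 2), 0 < s := by
    rw [map_norm_sq_complexGaussian hv, ae_map_iff (by fun_prop) measurableSet_Ioi]
    filter_upwards [ae_stdExp_pos] with t ht
    positivity
  rw [ae_map_iff (by fun_prop) measurableSet_Ioi] at h1
  filter_upwards [h1] with h hh h0
  simp [h0] at hh

/-! ### The nearest point of a Poisson process -/

section NearestUser

variable {Ω : Type*} {Φ : Ω → Set ℂ}

theorem pointCount_eq_zero_iff {B : Set ℂ} {ω : Ω} :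
    pointCount Φ B ω = 0 ↔ Disjoint (Φ ω) B := by
  rw [pointCount, Set.encard_eq_zero, Set.disjoint_iff_inter_eq_empty]

theorem measurable_pointCount_pointSigma {B : Set ℂ} (hB : MeasurableSet B) :
    Measurable[pointSigma Φ] (pointCount Φ B) := by
  refine Measurable.mono (ma := MeasurableSpace.comap (pointCount Φ B) ⊤) (mb := ⊤) ?_ ?_ le_rfl
  · exact comap_measurable _
  · exact le_iSup₂ (f := fun (B : Set ℂ) (_ : MeasurableSet B) =>
      MeasurableSpace.comap (pointCount Φ B) ⊤) B hB

theorem nearestDist_ge_iff {ω : Ω} {a : ℝ} (ha : 0 < a) :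
    a ≤ nearestDist (Φ ω) ↔
      pointCount Φ (Metric.ball 0 a) ω = 0 ∧ pointCount Φ Set.univ ω ≠ 0 := by
  rw [pointCount_eq_zero_iff, Ne, pointCount_eq_zero_iff, Set.disjoint_univ]
  by_cases hne : Φ ω = ∅
  · simp [hne, nearestDist, ha]
  · simp only [hne, not_false_eq_true, and_true, nearestDist]
    rw [Metric.le_infDist (Set.nonempty_iff_ne_empty.2 hne), Set.disjoint_left]
    refine forall₂_congr fun y _ => ?_
    rw [Metric.mem_ball, not_lt, dist_comm]

theorem measurable_nearestDist_pointSigma :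
    Measurable[pointSigma Φ] fun ω => nearestDist (Φ ω) := by
  let := pointSigma Φ
  refine measurable_of_Ici fun a => ?_
  rcases le_or_gt a 0 with ha | ha
  · have : (fun ω => nearestDist (Φ ω)) ⁻¹' Set.Ici a = Set.univ :=
      Set.eq_univ_of_forall fun ω => ha.trans Metric.infDist_nonneg
    rw [this]
    exact @MeasurableSet.univ _ (pointSigma Φ)
  · have : (fun ω => nearestDist (Φ ω)) ⁻¹' Set.Ici a
        = (pointCount Φ (Metric.ball 0 a)) ⁻¹' {0} ∩ (pointCount Φ Set.univ) ⁻¹' {0}ᶜ := by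
      ext ω
      exact nearestDist_ge_iff ha
    rw [this]
    exact @MeasurableSet.inter _ (pointSigma Φ) _ _
      (measurable_pointCount_pointSigma measurableSet_ball (measurableSet_singleton _))
      (measurable_pointCount_pointSigma MeasurableSet.univ (measurableSet_singleton _).compl)

variable [MeasurableSpace Ω] {P : Measure Ω} {lam : ℝ≥0}

theorem measure_pointCount_eq_zero (h : IsHomogeneousPPP P lam Φ) {B : Set ℂ}
    (hB : MeasurableSet B) (hv : volume B ≠ ⊤) :
    P {ω | pointCount Φ B ω = 0} = ENNReal.ofReal (Real.exp (-(lam * (volume B).toReal))) := by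
  have h1 : P {ω | pointCount Φ B ω = 0} = P.map (pointCount Φ B) {0} := by
    rw [Measure.map_apply (h.measurable_count B hB) (measurableSet_singleton _)]
    rfl
  rw [h1, h.law_count B hB hv, Measure.map_apply (measurable_of_countable _)
    (measurableSet_singleton _)]
  have h2 : (fun n : ℕ => (n : ℕ∞)) ⁻¹' {0} = {0} := by ext n; simp
  rw [h2, poissonMeasure_singleton]
  simp [ENNReal.coe_toNNReal_eq_toReal]

theorem measure_pointCount_ball_eq_zero (h : IsHomogeneousPPP P lam Φ) {a : ℝ} (ha : 0 ≤ a) :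
    P {ω | pointCount Φ (Metric.ball 0 a) ω = 0}
      = ENNReal.ofReal (Real.exp (-(Real.pi * lam * a ^ 2))) := by
  rw [measure_pointCount_eq_zero h measurableSet_ball measure_ball_lt_top.ne, Complex.volume_ball]
  congr 3
  simp [ENNReal.toReal_ofReal ha]
  ring

theorem ae_nonempty (h : IsHomogeneousPPP P lam Φ) (hlam : 0 < lam) :
    ∀ᵐ ω ∂P, (Φ ω).Nonempty := by
  have hl : (0 : ℝ) < lam := by exact_mod_cast hlam
  have hle : ∀ n : ℕ, P {ω | ¬ (Φ ω).Nonempty}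
      ≤ ENNReal.ofReal (Real.exp (-(Real.pi * lam * (n : ℝ) ^ 2))) := by
    intro n
    rw [← measure_pointCount_ball_eq_zero h (Nat.cast_nonneg n)]
    refine measure_mono fun ω hω => ?_
    have : Φ ω = ∅ := Set.not_nonempty_iff_eq_empty.1 hω
    exact pointCount_eq_zero_iff.2 (by simp [this])
  have hlim : Filter.Tendsto (fun n : ℕ =>
      ENNReal.ofReal (Real.exp (-(Real.pi * lam * (n : ℝ) ^ 2)))) Filter.atTop (nhds 0) := by
    rw [← ENNReal.ofReal_zero]
    refine ENNReal.tendsto_ofReal (Real.tendsto_exp_neg_atTop_nhds_zero.comp ?_)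
    refine Filter.Tendsto.const_mul_atTop (by positivity) ?_
    exact (Filter.tendsto_pow_atTop two_ne_zero).comp tendsto_natCast_atTop_atTop
  exact le_antisymm (ge_of_tendsto' hlim hle) zero_le

theorem pointSigma_le (h : IsHomogeneousPPP P lam Φ) : pointSigma Φ ≤ ‹MeasurableSpace Ω› :=
  iSup₂_le fun B hB => (h.measurable_count B hB).comap_le

/-- The void probabilities of the Poisson process give the law of the distance to the nearest
point: `π * lam * r ^ 2` is standard exponential. -/
theorem map_nearestDist [IsProbabilityMeasure P] (h : IsHomogeneousPPP P lam Φ) (hlam : 0 < lam) :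
    P.map (fun ω => nearestDist (Φ ω)) = stdExp.map fun t => √(t / (Real.pi * lam)) := by
  have hl : (0 : ℝ) < lam := by exact_mod_cast hlam
  have hm : Measurable fun ω => nearestDist (Φ ω) :=
    measurable_nearestDist_pointSigma.mono (pointSigma_le h) le_rfl
  have := Measure.isProbabilityMeasure_map (μ := P) hm.aemeasurable
  refine Measure.ext_of_Ici _ _ fun a => ?_
  rw [Measure.map_apply hm measurableSet_Ici, Measure.map_apply (by fun_prop) measurableSet_Ici]
  rcases le_or_gt a 0 with ha | ha
  · have h1 : (fun ω => nearestDist (Φ ω)) ⁻¹' Set.Ici a = Set.univ :=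
      Set.eq_univ_of_forall fun ω => ha.trans Metric.infDist_nonneg
    have h2 : (fun t : ℝ => √(t / (Real.pi * lam))) ⁻¹' Set.Ici a = Set.univ :=
      Set.eq_univ_of_forall fun t => ha.trans (Real.sqrt_nonneg _)
    rw [h1, h2, measure_univ, measure_univ]
  · have h2 : (fun t : ℝ => √(t / (Real.pi * lam))) ⁻¹' Set.Ici a
        = Set.Ici (Real.pi * lam * a ^ 2) := by
      ext t
      simp only [Set.mem_preimage, Set.mem_Ici]
      rw [Real.le_sqrt' ha, le_div_iff₀ (by positivity), mul_comm]
    rw [h2, stdExp_Ici (by positivity), ← measure_pointCount_ball_eq_zero h ha.le]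
    refine measure_congr ?_
    filter_upwards [ae_nonempty h hlam] with ω hω
    refine propext ((nearestDist_ge_iff ha).trans (and_iff_left ?_))
    rw [Ne, pointCount_eq_zero_iff, Set.disjoint_univ]
    exact hω.ne_empty

end NearestUser

/-! ### A rearrangement inequality -/

section Rearrangement

/-- The reflection of the plane that exchanges `0` and `d`. -/
def reflection (d : ℝ) (x : ℂ) : ℂ := (d : ℂ) - (starRingEnd ℂ) x

theorem norm_reflection (d : ℝ) (x : ℂ) : ‖reflection d x‖ = ‖x - d‖ := by
  rw [reflection, ← RCLike.norm_conj, map_sub, Complex.conj_ofReal, Complex.conj_conj,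
    norm_sub_rev]

theorem reflection_reflection (d : ℝ) (x : ℂ) : reflection d (reflection d x) = x := by
  simp [reflection]

theorem measurePreserving_reflection (d : ℝ) : MeasurePreserving (reflection d) := by
  have h1 : MeasurePreserving (fun x : ℂ => (starRingEnd ℂ) x) :=
    Complex.conjLIE.measurePreserving
  exact (Measure.measurePreserving_sub_left volume (d : ℂ)).comp h1

/-- The two-point rearrangement inequality: if the density `a ‖x‖` and the function `b ‖x‖` both
decrease with the distance from the origin, then replacing `b ‖x‖` by `b ‖x - d‖` decreases the
integral. The reflection exchanging `0` and `d` turns `‖x‖` into `‖x - d‖`, and the difference of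
the integrals is half the integral of a product of two differences of equal sign. -/
theorem integral_mul_comp_norm_sub_lt {a b : ℝ → ℝ} {d R : ℝ} (hd : 0 < d) (hR : 0 < R)
    (ha : Measurable a) (hb : Measurable b) (ha0 : ∀ r, 0 ≤ a r) (hb0 : ∀ r, 0 ≤ b r)
    (hanti : AntitoneOn a (Set.Ici 0)) (hastrict : ∀ r s, 0 ≤ r → r < R → r < s → a s < a r)
    (hbanti : StrictAntiOn b (Set.Ioi 0))
    (hint : Integrable fun x : ℂ => a ‖x‖ * b ‖x‖) :
    Integrable (fun x : ℂ => a ‖x‖ * b ‖x - d‖) ∧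
      ∫ x : ℂ, a ‖x‖ * b ‖x - d‖ < ∫ x : ℂ, a ‖x‖ * b ‖x‖ := by
  have hτ := measurePreserving_reflection d
  have hτe : MeasurableEmbedding (reflection d) :=
    MeasurableEquiv.measurableEmbedding ⟨⟨reflection d, reflection d, reflection_reflection d,
      reflection_reflection d⟩, hτ.measurable, hτ.measurable⟩
  have hnorm : ∀ x, ‖reflection d x - d‖ = ‖x‖ := fun x => by
    rw [← norm_reflection, reflection_reflection]
  have hint' : Integrable fun x : ℂ => a ‖x - d‖ * b ‖x - d‖ := by
    have := (hτ.integrable_comp_emb hτe).2 hint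
    simpa only [Function.comp_def, norm_reflection] using this
  have hne : ∀ᵐ x : ℂ, 0 < ‖x‖ ∧ 0 < ‖x - d‖ := by
    have h1 : ∀ y : ℂ, ∀ᵐ x : ℂ, x ≠ y := fun y =>
      compl_mem_ae_iff.2 (measure_singleton y)
    filter_upwards [h1 0, h1 d] with x hx hxd
    exact ⟨norm_pos_iff.2 hx, norm_pos_iff.2 (sub_ne_zero.2 hxd)⟩
  have hprod : ∀ r s, 0 < r → 0 < s → 0 ≤ (a r - a s) * (b r - b s) := by
    intro r s hr hs
    rcases le_total r s with h | h
    · exact mul_nonneg (sub_nonneg.2 (hanti hr.le hs.le h))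
        (sub_nonneg.2 (hbanti.antitoneOn hr hs h))
    · exact mul_nonneg_of_nonpos_of_nonpos (sub_nonpos.2 (hanti hs.le hr.le h))
        (sub_nonpos.2 (hbanti.antitoneOn hs hr h))
  have hint1 : Integrable (fun x : ℂ => a ‖x‖ * b ‖x - d‖) := by
    refine Integrable.mono' (hint.add hint') (Measurable.aestronglyMeasurable (by fun_prop)) ?_
    filter_upwards [hne] with x hx
    rw [Real.norm_of_nonneg (mul_nonneg (ha0 _) (hb0 _))]
    have h1 := hprod _ _ hx.1 hx.2
    have h2 := mul_nonneg (ha0 ‖x - d‖) (hb0 ‖x‖)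
    simp only [Pi.add_apply]
    linarith
  have hint2 : Integrable (fun x : ℂ => a ‖x - d‖ * b ‖x‖) := by
    have := (hτ.integrable_comp_emb hτe).2 hint1
    simpa only [Function.comp_def, norm_reflection, hnorm] using this
  have heq1 : ∫ x : ℂ, a ‖x - d‖ * b ‖x - d‖ = ∫ x : ℂ, a ‖x‖ * b ‖x‖ := by
    rw [← hτ.integral_comp hτe (fun x => a ‖x‖ * b ‖x‖)]
    simp only [norm_reflection]
  have heq2 : ∫ x : ℂ, a ‖x - d‖ * b ‖x‖ = ∫ x : ℂ, a ‖x‖ * b ‖x - d‖ := by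
    rw [← hτ.integral_comp hτe (fun x => a ‖x‖ * b ‖x - d‖)]
    simp only [norm_reflection, hnorm]
  refine ⟨hint1, ?_⟩
  have hpos : 0 < ∫ x : ℂ, ((a ‖x‖ * b ‖x‖ + a ‖x - d‖ * b ‖x - d‖)
      - (a ‖x‖ * b ‖x - d‖ + a ‖x - d‖ * b ‖x‖)) := by
    have hfac : ∀ x : ℂ, ((a ‖x‖ * b ‖x‖ + a ‖x - d‖ * b ‖x - d‖)
        - (a ‖x‖ * b ‖x - d‖ + a ‖x - d‖ * b ‖x‖))
        = (a ‖x‖ - a ‖x - d‖) * (b ‖x‖ - b ‖x - d‖) := fun x => by ring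
    rw [integral_pos_iff_support_of_nonneg_ae]
    · -- the integrand is positive near any negative real of small modulus
      have hopen : IsOpen {x : ℂ | 0 < ‖x‖ ∧ ‖x‖ < R ∧ ‖x‖ < ‖x - d‖} :=
        (isOpen_lt continuous_const continuous_norm).inter
          ((isOpen_lt continuous_norm continuous_const).inter
            (isOpen_lt continuous_norm (by fun_prop)))
      have hnonempty : {x : ℂ | 0 < ‖x‖ ∧ ‖x‖ < R ∧ ‖x‖ < ‖x - d‖}.Nonempty := by
        refine ⟨((-(R / 2) : ℝ) : ℂ), ?_⟩
        simp only [Set.mem_ofPred_eq]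
        rw [← Complex.ofReal_sub, Complex.norm_real, Complex.norm_real, Real.norm_eq_abs,
          Real.norm_eq_abs, abs_of_neg (by linarith), abs_of_neg (by linarith)]
        refine ⟨by linarith, by linarith, by linarith⟩
      refine lt_of_lt_of_le (hopen.measure_pos volume hnonempty) (measure_mono fun x hx => ?_)
      rw [Function.mem_support, hfac]
      refine (mul_pos (sub_pos.2 (hastrict _ _ hx.1.le hx.2.1 hx.2.2)) (sub_pos.2 ?_)).ne'
      exact hbanti hx.1 (hx.1.trans hx.2.2) hx.2.2
    · filter_upwards [hne] with x hx
      rw [hfac]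
      exact hprod _ _ hx.1 hx.2
    · exact (hint.add hint').sub (hint1.add hint2)
  have hdiff : ∫ x : ℂ, ((a ‖x‖ * b ‖x‖ + a ‖x - d‖ * b ‖x - d‖)
      - (a ‖x‖ * b ‖x - d‖ + a ‖x - d‖ * b ‖x‖))
      = (∫ x : ℂ, (a ‖x‖ * b ‖x‖ + a ‖x - d‖ * b ‖x - d‖))
        - ∫ x : ℂ, (a ‖x‖ * b ‖x - d‖ + a ‖x - d‖ * b ‖x‖) :=
    integral_sub (hint.add hint') (hint1.add hint2)
  rw [hdiff, integral_add hint hint', integral_add hint1 hint2, heq1, heq2] at hpos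
  linarith

end Rearrangement

/-! ### Independence and the average over the channels -/

section Independence

variable {Ω : Type*} [mΩ : MeasurableSpace Ω] {P : Measure Ω}

theorem indepFun_of_iIndep {ι : Type*} [Preorder ι] {m : ι → MeasurableSpace Ω}
    (hm : ∀ i, m i ≤ mΩ) (hind : iIndep m P) {β γ : Type*} [MeasurableSpace β]
    [MeasurableSpace γ] {X : Ω → β} {Y : Ω → γ} {i : ι} (hX : Measurable[m i] X)
    (hY : Measurable[⨆ j ∈ Set.Ioi i, m j] Y) : IndepFun X Y P := by
  have h := indep_iSup_of_disjoint hm hind (S := {i}) (T := Set.Ioi i)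
    (Set.disjoint_singleton_left.2 (lt_irrefl i))
  rw [IndepFun_iff_Indep]
  refine indep_of_indep_of_le_left (indep_of_indep_of_le_right h hY.comap_le) ?_
  exact hX.comap_le.trans (le_iSup₂ (f := fun j (_ : j ∈ ({i} : Set ι)) => m j) i rfl)

theorem lintegral_comp_prodMk_of_indepFun [IsProbabilityMeasure P] {β γ : Type*}
    [MeasurableSpace β] [MeasurableSpace γ] {X : Ω → β} {Y : Ω → γ} (hX : Measurable X)
    (hY : Measurable Y) (hXY : IndepFun X Y P) {F : β × γ → ENNReal} (hF : Measurable F) :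
    ∫⁻ ω, F (X ω, Y ω) ∂P = ∫⁻ x, ∫⁻ ω, F (x, Y ω) ∂P ∂(P.map X) := by
  have := Measure.isProbabilityMeasure_map (μ := P) hX.aemeasurable
  have := Measure.isProbabilityMeasure_map (μ := P) hY.aemeasurable
  rw [← lintegral_map (μ := P) (g := fun ω => (X ω, Y ω)) hF (hX.prodMk hY),
    (indepFun_iff_map_prod_eq_prod_map_map hX.aemeasurable hY.aemeasurable).1 hXY,
    lintegral_prod _ hF.aemeasurable]
  refine lintegral_congr fun x => ?_
  rw [lintegral_map (by fun_prop) hY]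

/-- The expectation of a function of the nearest distance, the angle and the channels is an
iterated integral against their laws. -/
theorem lintegral_cell [IsProbabilityMeasure P] {nu nd : ℕ} {lam saa : ℝ≥0} {Φ : Ω → Set ℂ}
    {Θ : Ω → ℝ} {hua : Ω → Fin nu → ℂ} {had : Ω → Fin nd → ℂ} {Haa : Ω → Fin nu → Fin nd → ℂ}
    (hcell : IsCell P nu nd lam saa Φ Θ hua had Haa)
    {F : ℝ × ℝ × (Fin nu → ℂ) × (Fin nd → ℂ) × (Fin nu → Fin nd → ℂ) → ENNReal}
    (hF : Measurable F) :
    ∫⁻ ω, F (nearestDist (Φ ω), Θ ω, hua ω, had ω, Haa ω) ∂P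
      = ∫⁻ r, ∫⁻ θ, ∫⁻ u, ∫⁻ g, ∫⁻ H, F (r, θ, u, g, H)
          ∂(Measure.pi fun _ => Measure.pi fun _ => complexGaussian (saa ^ 2))
          ∂(Measure.pi fun _ => complexGaussian 1) ∂(Measure.pi fun _ => complexGaussian 1)
          ∂uniformAngle ∂(P.map fun ω => nearestDist (Φ ω)) := by
  set m : Fin 5 → MeasurableSpace Ω := ![pointSigma Φ, MeasurableSpace.comap Θ inferInstance,
    MeasurableSpace.comap hua inferInstance, MeasurableSpace.comap had inferInstance,
    MeasurableSpace.comap Haa inferInstance] with hmdef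
  have hm : ∀ i, m i ≤ mΩ := by
    intro i
    fin_cases i
    · exact pointSigma_le hcell.users
    · exact hcell.measurable_angle.comap_le
    · exact hcell.measurable_hua.comap_le
    · exact hcell.measurable_had.comap_le
    · exact hcell.measurable_Haa.comap_le
  have h0 : Measurable[m 0] fun ω => nearestDist (Φ ω) := measurable_nearestDist_pointSigma
  have h1 : Measurable[m 1] Θ := comap_measurable Θ
  have h2 : Measurable[m 2] hua := comap_measurable hua
  have h3 : Measurable[m 3] had := comap_measurable had
  have h4 : Measurable[m 4] Haa := comap_measurable Haa
  have hle : ∀ i j : Fin 5, i < j → m j ≤ ⨆ j ∈ Set.Ioi i, m j := fun i j hij =>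
    le_iSup₂ (f := fun j (_ : j ∈ Set.Ioi i) => m j) j hij
  have i3 : IndepFun had Haa P :=
    indepFun_of_iIndep hm hcell.indep h3 (h4.mono (hle 3 4 (by decide)) le_rfl)
  have i2 : IndepFun hua (fun ω => (had ω, Haa ω)) P :=
    indepFun_of_iIndep hm hcell.indep h2 ((h3.mono (hle 2 3 (by decide)) le_rfl).prodMk
      (h4.mono (hle 2 4 (by decide)) le_rfl))
  have i1 : IndepFun Θ (fun ω => (hua ω, had ω, Haa ω)) P :=
    indepFun_of_iIndep hm hcell.indep h1 ((h2.mono (hle 1 2 (by decide)) le_rfl).prodMk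
      ((h3.mono (hle 1 3 (by decide)) le_rfl).prodMk (h4.mono (hle 1 4 (by decide)) le_rfl)))
  have i0 : IndepFun (fun ω => nearestDist (Φ ω)) (fun ω => (Θ ω, hua ω, had ω, Haa ω)) P :=
    indepFun_of_iIndep hm hcell.indep h0 ((h1.mono (hle 0 1 (by decide)) le_rfl).prodMk
      ((h2.mono (hle 0 2 (by decide)) le_rfl).prodMk
      ((h3.mono (hle 0 3 (by decide)) le_rfl).prodMk (h4.mono (hle 0 4 (by decide)) le_rfl))))
  have m0 := h0.mono (hm 0) le_rfl
  have m1 := hcell.measurable_angle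
  have m2 := hcell.measurable_hua
  have m3 := hcell.measurable_had
  have m4 := hcell.measurable_Haa
  rw [lintegral_comp_prodMk_of_indepFun m0 (m1.prodMk (m2.prodMk (m3.prodMk m4))) i0 hF]
  refine lintegral_congr fun r => ?_
  rw [← hcell.law_angle, ← hcell.law_hua, ← hcell.law_had, ← hcell.law_Haa,
    lintegral_comp_prodMk_of_indepFun m1 (m2.prodMk (m3.prodMk m4)) i1
      (F := fun p => F (r, p)) (by fun_prop)]
  refine lintegral_congr fun θ => ?_
  rw [lintegral_comp_prodMk_of_indepFun m2 (m3.prodMk m4) i2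
    (F := fun p => F (r, θ, p)) (by fun_prop)]
  refine lintegral_congr fun u => ?_
  rw [lintegral_comp_prodMk_of_indepFun m3 m4 i3 (F := fun p => F (r, θ, u, p)) (by fun_prop)]
  refine lintegral_congr fun g => ?_
  rw [lintegral_map (by fun_prop) m4]

end Independence


theorem norm_toLp_fin_one (u : Fin 1 → ℂ) : ‖WithLp.toLp 2 u‖ = ‖u 0‖ := by
  rw [EuclideanSpace.norm_eq]
  simp

theorem sum_norm_sq_matchedVector {n : ℕ} {g : Fin n → ℂ} (hg : g ≠ 0) :
    ∑ j, ‖matchedVector g j‖ ^ 2 = 1 := by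
  have h0 : ‖WithLp.toLp 2 g‖ ≠ 0 := by
    rw [norm_ne_zero_iff]
    intro h
    exact hg (by simpa using congrArg WithLp.ofLp h)
  have h1 := EuclideanSpace.norm_sq_eq (WithLp.toLp 2 g)
  simp only [matchedVector, norm_div, norm_star, Complex.norm_real, Real.norm_eq_abs, abs_norm,
    div_pow, ← Finset.sum_div]
  rw [h1, div_self]
  rw [← h1]
  positivity

theorem sinrAP_matched {nd : ℕ} {Pu Pa l : ℝ} {u : Fin 1 → ℂ} (hu : u 0 ≠ 0)
    (H : Fin 1 → Fin nd → ℂ) (w : Fin nd → ℂ) :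
    sinrAP Pu Pa 0 l u H (matchedVector u) w
      = (Pu * l * ‖u 0‖ ^ 2) / (Pa * ‖∑ j, H 0 j * w j‖ ^ 2) := by
  have hu' : ‖u 0‖ ≠ 0 := norm_ne_zero_iff.2 hu
  have h1 : ‖matchedVector u 0‖ = 1 := by
    rw [matchedVector, norm_toLp_fin_one, norm_div, norm_star, Complex.norm_real, norm_norm,
      div_self hu']
  have h2 : ‖matchedVector u ⬝ᵥ u‖ = ‖u 0‖ := by
    simp [dotProduct, h1]
  have h3 : ‖matchedVector u ⬝ᵥ (Matrix.of H).mulVec w‖ = ‖∑ j, H 0 j * w j‖ := by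
    simp [dotProduct, Matrix.mulVec, h1]
  rw [sinrAP, h2, h3, zero_mul, add_zero]

/-- The uplink rate averaged over the channels. After matched filtering, the signal and the
interference powers are independent exponential variables. -/
theorem lintegral_channels {nd : ℕ} (hnd : 1 ≤ nd) {saa : ℝ≥0} (hsaa : 0 < saa) {Pu Pa l : ℝ}
    (hPu : 0 < Pu) (hPa : 0 < Pa) (hl : 0 ≤ l) :
    ∫⁻ u : Fin 1 → ℂ, ∫⁻ g : Fin nd → ℂ, ∫⁻ H : Fin 1 → Fin nd → ℂ, ENNReal.ofReal
        (Real.logb 2 (1 + sinrAP Pu Pa 0 l u H (matchedVector u) (matchedVector g)))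
        ∂(Measure.pi fun _ => Measure.pi fun _ => complexGaussian (saa ^ 2))
        ∂(Measure.pi fun _ => complexGaussian 1) ∂(Measure.pi fun _ => complexGaussian 1)
      = ENNReal.ofReal (meanLogRatio (Pu / (Pa * saa ^ 2) * l) / Real.log 2) := by
  have hs : (0 : ℝ) < saa := by exact_mod_cast hsaa
  set c := Pu / (Pa * (saa : ℝ) ^ 2) * l with hc
  have hc0 : 0 ≤ c := by positivity
  set J : ℝ → ENNReal := fun x => ∫⁻ y, ENNReal.ofReal (Real.logb 2 (1 + c * (x / y))) ∂stdExp
    with hJ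
  have hJm : Measurable J := by
    refine Measurable.lintegral_prod_right' (f := fun p : ℝ × ℝ =>
      ENNReal.ofReal (Real.logb 2 (1 + c * (p.1 / p.2)))) ?_
    unfold Real.logb
    fun_prop
  have hH : ∀ u : Fin 1 → ℂ, u 0 ≠ 0 → ∀ g : Fin nd → ℂ, g ≠ 0 →
      ∫⁻ H : Fin 1 → Fin nd → ℂ, ENNReal.ofReal
        (Real.logb 2 (1 + sinrAP Pu Pa 0 l u H (matchedVector u) (matchedVector g)))
        ∂(Measure.pi fun _ => Measure.pi fun _ => complexGaussian (saa ^ 2)) = J (‖u 0‖ ^ 2) := by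
    intro u hu g hg
    set f : ℝ → ENNReal := fun s =>
      ENNReal.ofReal (Real.logb 2 (1 + (Pu * l * ‖u 0‖ ^ 2) / (Pa * s))) with hf
    have hfm : Measurable f := by unfold f Real.logb; fun_prop
    simp_rw [sinrAP_matched hu]
    have e1 := (measurePreserving_eval (fun _ : Fin 1 => Measure.pi fun _ : Fin nd =>
      complexGaussian (saa ^ 2)) 0).lintegral_comp
        (f := fun h : Fin nd → ℂ => f (‖∑ j, h j * matchedVector g j‖ ^ 2)) (by fun_prop)
    refine e1.trans ?_
    rw [← lintegral_map (f := fun z : ℂ => f (‖z‖ ^ 2))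
        (g := fun h : Fin nd → ℂ => ∑ j, h j * matchedVector g j) (by fun_prop) (by fun_prop),
      map_sum_mul_pi_complexGaussian _ _ (sum_norm_sq_matchedVector hg),
      ← lintegral_map (f := f) (g := fun z : ℂ => ‖z‖ ^ 2) hfm (by fun_prop),
      map_norm_sq_complexGaussian (by positivity), lintegral_map hfm (by fun_prop)]
    refine lintegral_congr fun y => ?_
    simp only [hf]
    congr 3
    rw [hc, NNReal.coe_pow]
    field_simp
  have hu : ∀ᵐ u ∂(Measure.pi fun _ : Fin 1 => complexGaussian 1), u 0 ≠ 0 :=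
    (measurePreserving_eval (fun _ : Fin 1 => complexGaussian 1) 0).quasiMeasurePreserving.ae
      (ae_complexGaussian_ne_zero one_pos)
  have hg : ∀ᵐ g ∂(Measure.pi fun _ : Fin nd => complexGaussian 1), g ≠ 0 := by
    have := (measurePreserving_eval (fun _ : Fin nd => complexGaussian 1)
      ⟨0, hnd⟩).quasiMeasurePreserving.ae (ae_complexGaussian_ne_zero one_pos)
    filter_upwards [this] with g hg h0
    exact hg (by rw [h0]; rfl)
  have e2 : ∀ᵐ u ∂(Measure.pi fun _ : Fin 1 => complexGaussian 1),
      ∫⁻ g : Fin nd → ℂ, ∫⁻ H : Fin 1 → Fin nd → ℂ, ENNReal.ofReal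
        (Real.logb 2 (1 + sinrAP Pu Pa 0 l u H (matchedVector u) (matchedVector g)))
        ∂(Measure.pi fun _ => Measure.pi fun _ => complexGaussian (saa ^ 2))
        ∂(Measure.pi fun _ => complexGaussian 1) = J (‖u 0‖ ^ 2) := by
    filter_upwards [hu] with u hu
    refine (lintegral_congr_ae (hg.mono fun g hg => hH u hu g hg)).trans ?_
    rw [lintegral_const, measure_univ, mul_one]
  rw [lintegral_congr_ae e2]
  have e3 := (measurePreserving_eval (fun _ : Fin 1 => complexGaussian 1) 0).lintegral_comp
    (f := fun z : ℂ => J (‖z‖ ^ 2)) (by fun_prop)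
  refine e3.trans ?_
  rw [← lintegral_map (f := J) (g := fun z : ℂ => ‖z‖ ^ 2) hJm (by fun_prop),
    map_norm_sq_complexGaussian one_pos, lintegral_map hJm (by fun_prop)]
  have hlog : 0 < Real.log 2 := Real.log_pos one_lt_two
  rw [ENNReal.ofReal_div_of_pos hlog, ← lintegral_log_ratio hc0, div_eq_mul_inv,
    ← lintegral_mul_const _ (by
      refine Measurable.lintegral_prod_right' (f := fun p : ℝ × ℝ =>
        ENNReal.ofReal (Real.log (1 + c * (p.1 / p.2)))) (by fun_prop))]
  refine lintegral_congr fun x => ?_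
  rw [← lintegral_mul_const _ (by fun_prop)]
  refine lintegral_congr fun y => ?_
  rw [NNReal.coe_one, one_mul, Real.logb, ENNReal.ofReal_div_of_pos hlog, div_eq_mul_inv]

/-! ### The rate as an integral over the plane -/

/-- The density in the plane of a scheduled user in a uniformly random direction: the law of the
nearest point of the Poisson process, cut off at the cell radius. -/
def nearestDensity (lam Rc r : ℝ) : ℝ :=
  if r ≤ Rc then lam * Real.exp (-(Real.pi * lam * r ^ 2)) else 0

/-- The uplink rate averaged over the channels when the uplink user is at distance `s` from the
access point and `C = Pu / (Pa * saa ^ 2)`. -/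
def rateAtDist (C s : ℝ) : ℝ := meanLogRatio (C * (s ^ 4)⁻¹) / Real.log 2

@[fun_prop]
theorem measurable_nearestDensity (lam Rc : ℝ) : Measurable (nearestDensity lam Rc) := by
  unfold nearestDensity
  exact Measurable.ite measurableSet_Iic (by fun_prop) measurable_const

@[fun_prop]
theorem measurable_rateAtDist (C : ℝ) : Measurable (rateAtDist C) := by
  unfold rateAtDist
  fun_prop

theorem nearestDensity_nonneg {lam : ℝ} (hlam : 0 < lam) (Rc r : ℝ) :
    0 ≤ nearestDensity lam Rc r := by
  unfold nearestDensity
  split_ifs <;> positivity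

theorem rateAtDist_nonneg {C : ℝ} (hC : 0 < C) (s : ℝ) : 0 ≤ rateAtDist C s :=
  div_nonneg (meanLogRatio_nonneg (by positivity)) (Real.log_nonneg one_le_two)

theorem nearestDensity_lt {lam Rc : ℝ} (hlam : 0 < lam) {r s : ℝ} (hr : 0 ≤ r) (hrR : r ≤ Rc)
    (hrs : r < s) : nearestDensity lam Rc s < nearestDensity lam Rc r := by
  unfold nearestDensity
  rw [if_pos hrR]
  split_ifs with h
  · have := Real.pi_pos
    gcongr
  · positivity

theorem nearestDensity_antitoneOn {lam : ℝ} (hlam : 0 < lam) (Rc : ℝ) :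
    AntitoneOn (nearestDensity lam Rc) (Set.Ici 0) := by
  intro r hr s _ hrs
  rcases hrs.eq_or_lt with rfl | hrs
  · exact le_rfl
  rcases le_or_gt r Rc with h | h
  · exact (nearestDensity_lt hlam hr h hrs).le
  · have : nearestDensity lam Rc s = 0 := if_neg (not_le.2 (h.trans hrs))
    rw [this]
    exact nearestDensity_nonneg hlam Rc r

theorem rateAtDist_strictAntiOn {C : ℝ} (hC : 0 < C) :
    StrictAntiOn (rateAtDist C) (Set.Ioi 0) := by
  intro r hr s hs hrs
  have hr : 0 < r := hr
  have hs : 0 < s := hs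
  unfold rateAtDist
  refine div_lt_div_of_pos_right ?_ (Real.log_pos one_lt_two)
  refine meanLogRatio_strictMonoOn (Set.mem_Ioi.2 (by positivity)) (Set.mem_Ioi.2 (by positivity))
    ?_
  gcongr

theorem norm_ulPosition (r d θ : ℝ) :
    ‖ulPosition r d θ‖ = ‖(r : ℂ) * Complex.exp (θ * Complex.I) - d‖ := by
  have h0 : (starRingEnd ℂ) (Complex.exp (θ * Complex.I)) * Complex.exp (θ * Complex.I) = 1 := by
    rw [← Complex.exp_conj, ← Complex.exp_add]
    simp
  have h1 : ulPosition r d θ = (starRingEnd ℂ) ((r : ℂ) * Complex.exp (θ * Complex.I) - d) *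
      Complex.exp (θ * Complex.I) := by
    rw [ulPosition, map_sub, map_mul, Complex.conj_ofReal, Complex.conj_ofReal, sub_mul, mul_assoc,
      h0, mul_one]
  rw [h1, norm_mul, RCLike.norm_conj, Complex.norm_exp_ofReal_mul_I, mul_one]

theorem pathLoss_four (x : ℂ) : pathLoss 4 x = (‖x‖ ^ 4)⁻¹ := by
  rw [pathLoss, Real.rpow_neg (norm_nonneg _)]
  congr 1
  exact_mod_cast Real.rpow_natCast ‖x‖ 4

/-- The rate `uplinkRate` depends on the point set only through the nearest distance `r`; this is it
as a function of `r`, which is jointly measurable in all its arguments. -/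
def rateAt {nu nd : ℕ} (Pu Pa sn2 Rc d α r θ : ℝ) (hua : Fin nu → ℂ) (had : Fin nd → ℂ)
    (Haa : Fin nu → Fin nd → ℂ) : ℝ :=
  if r ≤ Rc then
    Real.logb 2 (1 + sinrAP Pu Pa sn2 (pathLoss α (ulPosition r d θ)) hua Haa
      (matchedVector hua) (matchedVector had))
  else 0

theorem uplinkRate_eq_rateAt {nu nd : ℕ} (Pu Pa sn2 Rc d α : ℝ) (S : Set ℂ) (θ : ℝ)
    (hua : Fin nu → ℂ) (had : Fin nd → ℂ) (Haa : Fin nu → Fin nd → ℂ) :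
    uplinkRate Pu Pa sn2 Rc d α S θ hua had Haa
      = rateAt Pu Pa sn2 Rc d α (nearestDist S) θ hua had Haa := by
  unfold uplinkRate rateAt
  split_ifs <;> rfl

@[fun_prop]
theorem measurable_matchedVector {n : ℕ} :
    Measurable (matchedVector : (Fin n → ℂ) → Fin n → ℂ) := by
  unfold matchedVector
  refine measurable_pi_lambda _ fun i => ?_
  have : Continuous fun h : Fin n → ℂ => ‖WithLp.toLp 2 h‖ := by fun_prop
  exact ((continuous_star.comp (continuous_apply i)).measurable).div
    (Complex.measurable_ofReal.comp this.measurable)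

theorem measurable_rateAt {nu nd : ℕ} (Pu Pa sn2 Rc d α : ℝ) :
    Measurable fun p : ℝ × ℝ × (Fin nu → ℂ) × (Fin nd → ℂ) × (Fin nu → Fin nd → ℂ) =>
      rateAt Pu Pa sn2 Rc d α p.1 p.2.1 p.2.2.1 p.2.2.2.1 p.2.2.2.2 := by
  unfold rateAt
  refine Measurable.ite (measurableSet_le measurable_fst measurable_const) ?_ measurable_const
  have hn : Measurable fun h : Fin nu → ℂ => ‖WithLp.toLp 2 h‖ :=
    Continuous.measurable (by fun_prop)
  unfold Real.logb sinrAP pathLoss ulPosition dotProduct Matrix.mulVec dotProduct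
  simp only [Matrix.of_apply]
  refine (Real.measurable_log.comp (measurable_const.add
    (Measurable.div ?_ (Measurable.add ?_ ?_)))).div_const _
  · fun_prop
  · fun_prop
  · exact measurable_const.mul ((hn.comp (measurable_matchedVector.comp (by fun_prop))).pow_const 2)

theorem rateAt_nonneg {nu nd : ℕ} {Pu Pa : ℝ} (hPu : 0 < Pu) (hPa : 0 < Pa) (Rc d α r θ : ℝ)
    (hua : Fin nu → ℂ) (had : Fin nd → ℂ) (Haa : Fin nu → Fin nd → ℂ) :
    0 ≤ rateAt Pu Pa 0 Rc d α r θ hua had Haa := by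
  unfold rateAt
  split_ifs
  · refine Real.logb_nonneg one_lt_two (le_add_of_nonneg_right ?_)
    unfold sinrAP pathLoss
    positivity
  · exact le_rfl

/-- Integrating over the nearest distance `r` and the uniform angle `θ` is integrating over the
plane in polar coordinates, since `2 * π * lam * r * exp (-π * lam * r ^ 2)` is the density of
`r`. -/
theorem lintegral_nearestDist_angle {Ω : Type*} [MeasurableSpace Ω] {P : Measure Ω}
    [IsProbabilityMeasure P] {lam : ℝ≥0} {Φ : Ω → Set ℂ} (hΦ : IsHomogeneousPPP P lam Φ)
    (hlam : 0 < lam) (Rc d : ℝ) {b : ℝ → ℝ} (hb : Measurable b) :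
    ∫⁻ r, ∫⁻ θ, (if r ≤ Rc then ENNReal.ofReal (b ‖ulPosition r d θ‖) else 0)
        ∂uniformAngle ∂(P.map fun ω => nearestDist (Φ ω))
      = ∫⁻ x : ℂ, ENNReal.ofReal (nearestDensity lam Rc ‖x‖ * b ‖x - d‖) := by
  have hl : (0 : ℝ) < lam := by exact_mod_cast hlam
  have hπ := Real.pi_pos
  have hm : Measurable fun p : ℝ × ℝ =>
      if p.1 ≤ Rc then ENNReal.ofReal (b ‖ulPosition p.1 d p.2‖) else 0 := by
    refine Measurable.ite (measurableSet_le measurable_fst measurable_const) ?_ measurable_const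
    unfold ulPosition
    fun_prop
  have : SFinite uniformAngle := by unfold uniformAngle; infer_instance
  have hG : Measurable fun r : ℝ =>
      ∫⁻ θ, (if r ≤ Rc then ENNReal.ofReal (b ‖ulPosition r d θ‖) else 0) ∂uniformAngle :=
    hm.lintegral_prod_right'
  rw [map_nearestDist hΦ hlam, lintegral_map hG (by fun_prop), lintegral_stdExp,
    ← lintegral_comp_mul_sq (b := Real.pi * lam) (by positivity),
    lintegral_complex_polar (by fun_prop)]
  refine setLIntegral_congr_fun measurableSet_Ioi fun r hr => ?_
  have hr : 0 < r := hr
  have h1 : √(Real.pi * lam * r ^ 2 / (Real.pi * lam)) = r := by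
    rw [mul_div_cancel_left₀ _ (by positivity), Real.sqrt_sq hr.le]
  have h2 : ∀ θ : ℝ, ‖(r : ℂ) * Complex.exp (θ * Complex.I)‖ = r := by
    intro θ
    rw [norm_mul, Complex.norm_exp_ofReal_mul_I, mul_one, Complex.norm_real,
      Real.norm_of_nonneg hr.le]
  simp only [h1, h2, ← norm_ulPosition]
  unfold nearestDensity
  split_ifs with h
  · simp_rw [ENNReal.ofReal_mul (show 0 ≤ (lam : ℝ) * Real.exp (-(Real.pi * lam * r ^ 2)) by
      positivity)]
    rw [lintegral_const_mul' _ _ ENNReal.ofReal_ne_top, uniformAngle, lintegral_smul_measure,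
      ← mul_assoc, smul_eq_mul, ← mul_assoc, ← mul_assoc (ENNReal.ofReal r),
      ← ENNReal.ofReal_mul (by positivity),
      ← ENNReal.ofReal_inv_of_pos (by positivity), ← ENNReal.ofReal_mul (by positivity),
      ← ENNReal.ofReal_mul (by positivity)]
    congr 2
    field_simp
  · simp

/-- Without displacement the planar integral is the one-dimensional integral summed by the
series. -/
theorem integral_nearestDensity_mul_rateAtDist {lam Rc C : ℝ} (hlam : 0 < lam) (hRc : 0 < Rc)
    (hC : 0 < C) :
    Integrable (fun x : ℂ => nearestDensity lam Rc ‖x‖ * rateAtDist C ‖x‖) ∧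
    ∫ x : ℂ, nearestDensity lam Rc ‖x‖ * rateAtDist C ‖x‖
      = (Real.log 2)⁻¹ * ∫ v in Set.Ioc (0 : ℝ) 1, (lam * Real.pi * Rc ^ 2) *
        Real.exp (-(lam * Real.pi * Rc ^ 2 * v)) * meanLogRatio (C / Rc ^ 4 / v ^ 2) := by
  have hlog : 0 < Real.log 2 := Real.log_pos one_lt_two
  have hπ := Real.pi_pos
  set A := lam * Real.pi * Rc ^ 2 with hA
  have hA0 : 0 < A := by positivity
  set f : ℝ → ℝ := fun v => A * Real.exp (-(A * v)) * meanLogRatio (C / Rc ^ 4 / v ^ 2) with hf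
  have hf0 : ∀ v, 0 ≤ f v := fun v =>
    mul_nonneg (by positivity) (meanLogRatio_nonneg (by positivity))
  have hfint : IntegrableOn f (Set.Ioc 0 1) := by
    refine Integrable.mono' ((integrableOn_meanLogRatio_div_sq
      (show 0 < C / Rc ^ 4 by positivity)).const_mul A)
      (Measurable.aestronglyMeasurable (by fun_prop)) ?_
    refine (ae_restrict_iff' measurableSet_Ioc).2 (Filter.Eventually.of_forall fun v hv => ?_)
    have hv0 : 0 < v := hv.1
    have h0 := meanLogRatio_nonneg (show 0 ≤ C / Rc ^ 4 / v ^ 2 by positivity)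
    rw [Real.norm_of_nonneg (hf0 v)]
    have h1 : Real.exp (-(A * v)) ≤ 1 := Real.exp_le_one_iff.2 (by nlinarith)
    simp only [hf]
    gcongr
    exact mul_le_of_le_one_right hA0.le h1
  have hnn : ∀ x : ℂ, 0 ≤ nearestDensity lam Rc ‖x‖ * rateAtDist C ‖x‖ := fun x =>
    mul_nonneg (nearestDensity_nonneg hlam _ _) (rateAtDist_nonneg hC _)
  have hlin : ∫⁻ x : ℂ, ENNReal.ofReal (nearestDensity lam Rc ‖x‖ * rateAtDist C ‖x‖)
      = ENNReal.ofReal ((Real.log 2)⁻¹ * ∫ v in Set.Ioc (0 : ℝ) 1, f v) := by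
    set F : ℝ → ENNReal := fun t =>
      ENNReal.ofReal (nearestDensity lam Rc √t * rateAtDist C √t) with hF
    have e1 : ∀ x : ℂ, ENNReal.ofReal (nearestDensity lam Rc ‖x‖ * rateAtDist C ‖x‖)
        = F (‖x‖ ^ 2) := by
      intro x
      simp only [hF, Real.sqrt_sq (norm_nonneg x)]
    simp_rw [e1]
    rw [lintegral_complex_norm_sq (by fun_prop)]
    -- the substitution `t = Rc ^ 2 * v`
    have h6 := lintegral_image_eq_lintegral_abs_deriv_mul (f := fun v : ℝ => Rc ^ 2 * v)
      (f' := fun _ => Rc ^ 2) (s := Set.Ioi 0) measurableSet_Ioi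
      (fun x _ => by simpa using ((hasDerivAt_id x).const_mul (Rc ^ 2)).hasDerivWithinAt)
      (fun x _ y _ h => mul_left_cancel₀ (by positivity) h) F
    rw [Set.image_mul_left_Ioi (by positivity), mul_zero] at h6
    rw [h6, ← lintegral_const_mul _ (by fun_prop), ENNReal.ofReal_mul (by positivity),
      ofReal_integral_eq_lintegral_ofReal hfint (Filter.Eventually.of_forall hf0),
      ← lintegral_const_mul _ (by fun_prop), ← Set.Ioi_inter_Iic,
      Set.inter_comm, ← Measure.restrict_restrict measurableSet_Iic,
      ← lintegral_indicator measurableSet_Iic]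
    refine setLIntegral_congr_fun measurableSet_Ioi fun v hv => ?_
    have hv : 0 < v := hv
    have hs : √(Rc ^ 2 * v) ≤ Rc ↔ v ≤ 1 := by
      rw [Real.sqrt_le_left hRc.le]
      exact mul_le_iff_le_one_right (by positivity)
    have hsq : √(Rc ^ 2 * v) ^ 2 = Rc ^ 2 * v := Real.sq_sqrt (by positivity)
    have hsq4 : √(Rc ^ 2 * v) ^ 4 = (Rc ^ 2 * v) ^ 2 := by
      rw [show 4 = 2 * 2 from rfl, pow_mul, hsq]
    simp only [hF, nearestDensity, rateAtDist, hs, hsq, hsq4, Set.indicator_apply, Set.mem_Iic]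
    split_ifs with h
    · rw [← ENNReal.ofReal_mul (by positivity), ← ENNReal.ofReal_mul (by positivity),
        ← ENNReal.ofReal_mul (by positivity)]
      congr 1
      have h7 : C * ((Rc ^ 2 * v) ^ 2)⁻¹ = C / Rc ^ 4 / v ^ 2 := by field_simp
      have h8 : Real.pi * lam * (Rc ^ 2 * v) = A * v := by rw [hA]; ring
      simp only [hf]
      rw [h7, h8, abs_of_pos (by positivity), hA]
      field_simp
    · simp
  have hint : Integrable (fun x : ℂ => nearestDensity lam Rc ‖x‖ * rateAtDist C ‖x‖) := by
    refine (lintegral_ofReal_ne_top_iff_integrable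
      (Measurable.aestronglyMeasurable (by fun_prop)) (Filter.Eventually.of_forall hnn)).1 ?_
    rw [hlin]
    exact ENNReal.ofReal_ne_top
  refine ⟨hint, ?_⟩
  rw [integral_eq_lintegral_of_nonneg_ae (Filter.Eventually.of_forall hnn)
    hint.aestronglyMeasurable, hlin, ENNReal.toReal_ofReal]
  exact mul_nonneg (by positivity) (setIntegral_nonneg measurableSet_Ioc fun v _ => hf0 v)

/-- The spatial average rate is a planar integral: the nearest downlink user, turned by the angle,
has a rotation invariant law, and the uplink user is at distance `‖x - d‖`. -/
theorem lintegral_uplinkRate {Ω : Type*} [MeasurableSpace Ω] {P : Measure Ω}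
    [IsProbabilityMeasure P] {nd : ℕ} (hnd : 1 ≤ nd) {lam saa : ℝ≥0} (hlam : 0 < lam)
    (hsaa : 0 < saa) {Pu Pa : ℝ} (hPu : 0 < Pu) (hPa : 0 < Pa) (Rc d : ℝ) {Φ : Ω → Set ℂ}
    {Θ : Ω → ℝ} {hua : Ω → Fin 1 → ℂ} {had : Ω → Fin nd → ℂ} {Haa : Ω → Fin 1 → Fin nd → ℂ}
    (hcell : IsCell P 1 nd lam saa Φ Θ hua had Haa) :
    ∫⁻ ω, ENNReal.ofReal
        (uplinkRate Pu Pa 0 Rc d 4 (Φ ω) (Θ ω) (hua ω) (had ω) (Haa ω)) ∂P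
      = ∫⁻ x : ℂ, ENNReal.ofReal (nearestDensity lam Rc ‖x‖ *
          rateAtDist (Pu / (Pa * saa ^ 2)) ‖x - d‖) := by
  simp_rw [uplinkRate_eq_rateAt]
  rw [lintegral_cell hcell (F := fun p => ENNReal.ofReal
    (rateAt Pu Pa 0 Rc d 4 p.1 p.2.1 p.2.2.1 p.2.2.2.1 p.2.2.2.2))
    (measurable_rateAt Pu Pa 0 Rc d 4).ennreal_ofReal,
    ← lintegral_nearestDist_angle hcell.users hlam Rc d (measurable_rateAtDist _)]
  refine lintegral_congr fun r => lintegral_congr fun θ => ?_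
  unfold rateAt
  split_ifs with h
  · dsimp only
    rw [pathLoss_four]
    exact lintegral_channels hnd hsaa hPu hPa (by positivity)
  · simp

end FullDuplex

end

theorem proposition2 {Ω : Type*} [MeasurableSpace Ω] (P : Measure Ω) [IsProbabilityMeasure P]
    (nd : ℕ) (hnd : 1 ≤ nd) (lam saa : ℝ≥0) (hlam : 0 < lam) (hsaa : 0 < saa)
    (Pu Pa Rc d : ℝ) (hPu : 0 < Pu) (hPa : 0 < Pa) (hRc : 0 < Rc) (hd : 0 < d)
    (Φ : Ω → Set ℂ) (Θ : Ω → ℝ) (hua : Ω → Fin 1 → ℂ) (had : Ω → Fin nd → ℂ)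
    (Haa : Ω → Fin 1 → Fin nd → ℂ)
    (hcell : FullDuplex.IsCell P 1 nd lam saa Φ Θ hua had Haa) :
    Integrable (fun ω =>
        FullDuplex.uplinkRate Pu Pa 0 Rc d 4 (Φ ω) (Θ ω) (hua ω) (had ω) (Haa ω)) P ∧
      ∃ S : ℝ,
        HasSum (fun k : ℕ =>
          (-1 : ℂ) ^ k * (((lam : ℝ) * Real.pi * Rc ^ 2 : ℝ) : ℂ) ^ (k + 1) /
              Complex.Gamma ((k : ℂ) + 1) *
            FullDuplex.meijerG 3 2 ![1, 1, 1 + ((k : ℂ) + 1) / 2] ![1, 1, ((k : ℂ) + 1) / 2]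
              ((Pu / Pa * (1 / (Rc ^ 4 * (saa : ℝ) ^ 2)) : ℝ) : ℂ)) (S : ℂ) ∧
        ∫ ω, FullDuplex.uplinkRate Pu Pa 0 Rc d 4 (Φ ω) (Θ ω) (hua ω) (had ω) (Haa ω) ∂P
          < 1 / (2 * Real.log 2) * S := by
  have hl : (0 : ℝ) < lam := by exact_mod_cast hlam
  have hs : (0 : ℝ) < saa := by exact_mod_cast hsaa
  have hlog : 0 < Real.log 2 := Real.log_pos one_lt_two
  set C : ℝ := Pu / (Pa * (saa : ℝ) ^ 2) with hC
  have hC0 : 0 < C := by positivity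
  have hz : Pu / Pa * (1 / (Rc ^ 4 * (saa : ℝ) ^ 2)) = C / Rc ^ 4 := by
    rw [hC]; field_simp
  have hz0 : 0 < C / Rc ^ 4 := by positivity
  obtain ⟨hint, hval⟩ := FullDuplex.integral_nearestDensity_mul_rateAtDist hl hRc hC0
  obtain ⟨hint', hlt⟩ := FullDuplex.integral_mul_comp_norm_sub_lt
    (a := FullDuplex.nearestDensity lam Rc) (b := FullDuplex.rateAtDist C) hd hRc (by fun_prop)
    (by fun_prop) (FullDuplex.nearestDensity_nonneg hl Rc) (FullDuplex.rateAtDist_nonneg hC0)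
    (FullDuplex.nearestDensity_antitoneOn hl Rc)
    (fun r s hr hrR hrs => FullDuplex.nearestDensity_lt hl hr hrR.le hrs)
    (FullDuplex.rateAtDist_strictAntiOn hC0) hint
  have hnn : ∀ x : ℂ, 0 ≤ FullDuplex.nearestDensity lam Rc ‖x‖ * FullDuplex.rateAtDist C ‖x - d‖ :=
    fun x => mul_nonneg (FullDuplex.nearestDensity_nonneg hl _ _)
      (FullDuplex.rateAtDist_nonneg hC0 _)
  have hrate0 : ∀ ω, 0 ≤
      FullDuplex.uplinkRate Pu Pa 0 Rc d 4 (Φ ω) (Θ ω) (hua ω) (had ω) (Haa ω) := fun ω => by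
    rw [FullDuplex.uplinkRate_eq_rateAt]
    exact FullDuplex.rateAt_nonneg hPu hPa ..
  have hmeas : Measurable fun ω =>
      FullDuplex.uplinkRate Pu Pa 0 Rc d 4 (Φ ω) (Θ ω) (hua ω) (had ω) (Haa ω) := by
    simp_rw [FullDuplex.uplinkRate_eq_rateAt]
    have hr : Measurable fun ω => FullDuplex.nearestDist (Φ ω) :=
      FullDuplex.measurable_nearestDist_pointSigma.mono
        (FullDuplex.pointSigma_le hcell.users) le_rfl
    exact (FullDuplex.measurable_rateAt Pu Pa 0 Rc d 4).comp
      (hr.prodMk (hcell.measurable_angle.prodMk (hcell.measurable_hua.prodMk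
        (hcell.measurable_had.prodMk hcell.measurable_Haa))))
  have hlin := FullDuplex.lintegral_uplinkRate hnd hlam hsaa hPu hPa Rc d hcell
  rw [← ofReal_integral_eq_lintegral_ofReal hint' (Filter.Eventually.of_forall hnn)] at hlin
  refine ⟨?_, 2 * ∫ v in Set.Ioc (0 : ℝ) 1, (lam * Real.pi * Rc ^ 2) *
      Real.exp (-(lam * Real.pi * Rc ^ 2 * v)) * FullDuplex.meanLogRatio (C / Rc ^ 4 / v ^ 2),
      ?_, ?_⟩
  · refine (lintegral_ofReal_ne_top_iff_integrable hmeas.aestronglyMeasurable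
      (Filter.Eventually.of_forall hrate0)).1 ?_
    rw [hlin]
    exact ENNReal.ofReal_ne_top
  · rw [hz]
    have hsum := (FullDuplex.hasSum_powerMoment (lam * Real.pi * Rc ^ 2) hz0).mul_left 2
    have hsumC := Complex.hasSum_ofReal.2 hsum
    refine Eq.subst (motive := fun f : ℕ → ℂ => HasSum f _) (funext fun k => ?_) hsumC
    rw [FullDuplex.meijerG_eq_powerMoment k hz0, Complex.Gamma_nat_eq_factorial]
    push_cast
    ring
  · rw [integral_eq_lintegral_of_nonneg_ae (Filter.Eventually.of_forall hrate0)
      hmeas.aestronglyMeasurable, hlin, ENNReal.toReal_ofReal (integral_nonneg hnn)]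
    refine hlt.trans_eq ?_
    rw [hval]
    field_simp
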